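/- **Conventions.** A pencil $L(\lambda)=\begin{bmatrix}A(\lambda)&-B(\lambda)\\ C(\lambda)&D(\lambda)\end{bmatrix}\in\mathbb{C}[\lambda]^{(p+m)\times(p+n)}$ (all entries of degree at most $1$, $A$ of size $p\times p$, $p\ge 0$) is a \emph{strongly minimal linearization} of $R(\lambda)\in\mathbb{C}(\lambda)^{m\times n}$ if $\det A(\lambda)\not\equiv 0$, $R=D+CA^{-1}B$, and $[A(\lambda)\ \ {-B(\lambda)}]$ and $\begin{bmatrix}A(\lambda)\\ C(\lambda)\end{bmatrix}$ have rank $p$ at every $\lambda_0\in\mathbb{C}$ and at infinity (the rank of a pencil at infinity is the rank of its coefficient of $\lambda$). A rational matrix is \emph{strictly proper} if in each entry the numerator has smaller degree than the denominator. **Theorem.** Let $R(\lambda)\in\mathbb{C}(\lambda)^{m\times n}$ be an arbitrary rational matrix (regular or singular, possibly rectangular). Then $R=P+R_{sp}$ for a unique polynomial matrix $P(\lambda)=\sum_i P_i\lambda^i$ and a unique strictly proper rational matrix $R_{sp}(\lambda)=R_{-1}\lambda^{-1}+R_{-2}\lambda^{-2}+\cdots$ (Laurent expansion at infinity). *Polynomial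 part.* Let $d$ be an integer with $d\ge\deg P$ (for instance $d=\deg P$), $d\ge 0$. Put $P_i=0$ for $i>d$, and with block indices $0\le a,b\le d-2$ let $T=[P_{2d-2-a-b}]_{a,b}$ (block Hankel, with $P_d$ on the block antidiagonal, zero above it, and $P_2$ in the last position) and $$L_s=\begin{bmatrix}A_s&-B_s\\ C_s&D_s\end{bmatrix},\quad A_s=[\lambda P_{2d-1-a-b}-P_{2d-2-a-b}]_{a,b},\quad -B_s=[\lambda P_{d-a}]_a,\quad C_s=[\lambda P_{d-b}]_b,\quad D_s=\lambda P_1+P_0$$ (for $d\le 1$ the blocks $T,A_s,B_s,C_s$ are empty and $L_s=D_s$). Let $r=\operatorname{rank}T$ and let $U=[U_1\ U_2]$, $V=[V_1\ V_2]$ be unitary with $U^*TV=\begin{bmatrix}0&0\\0&\widehat T\end{bmatrix}$, $\widehat T=U_2^*TV_2$ of size $r\times r$ and invertible. Set $$\widehat L_s=\begin{bmatrix}\widehat A_s&-\widehat B_s\\ \widehat C_s&\widehat D_s\end{bmatrix}:=\begin{bmatrix}U_2^*A_sV_2&-U_2^*B_s\\ C_sV_2&D_s\end{bmatrix}.$$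 *Strictly proper part.* For $k\ge 1$ and $1\le a,b\le k$ let $H=[R_{-(a+b-1)}]_{a,b}$ and $H_\sigma=[R_{-(a+b)}]_{a,b}$ ($k\times k$ block matrices). Then for all sufficiently large $k$ the rank of $H$ equals the total polar degree of the finite poles of $R_{sp}$, that is, the sum of the degrees of the denominators in the Smith--McMillan form of $R_{sp}$. Let $k\ge 1$ be any integer for which this equality holds, let $r_f=\operatorname{rank}H$ and let $U'=[U_1'\ U_2']$, $V'=[V_1'\ V_2']$ be unitary with $U'^*HV'=\begin{bmatrix}\widehat H&0\\0&0\end{bmatrix}$, $\widehat H=U_1'^*HV_1'$ of size $r_f\times r_f$ and invertible. Let $U_{11}$ and $V_{11}$ consist of the first $m$ rows of $U_1'$ and the first $n$ rows of $V_1'$, and set $$L_{sp}=\begin{bmatrix}A_{sp}&-B_{sp}\\ C_{sp}&0\end{bmatrix}:=\begin{bmatrix}U_1'^*H_\sigma V_1'-\lambda\widehat H&\widehat HV_{11}^*\\ U_{11}\widehat H&0\end{bmatrix}.$$ Then $\widehat L_s$ is a strongly minimal linearization of $P$, $L_{sp}$ is a strongly minimal linearization of $R_{sp}$, and $$L(\lambda)=\begin{bmatrix}\widehat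 A_s&0&-\widehat B_s\\ 0&A_{sp}&-B_{sp}\\ \widehat C_s&C_{sp}&\widehat D_s\end{bmatrix},$$ partitioned with leading block $\operatorname{diag}(\widehat A_s,A_{sp})$, is a strongly minimal linearization of $R(\lambda)$. -/

import Mathlib

open Polynomial
open scoped Matrix

noncomputable section

namespace RationalLinearization

/-- The constant polynomial matrix with the given complex entries. -/
def constMatrix {p q : Type*} (M : Matrix p q ℂ) : Matrix p q ℂ[X] := M.map Polynomial.C

/-- A polynomial matrix seen as a rational matrix. -/
def toRat {p q : Type*} (M : Matrix p q ℂ[X]) : Matrix p q (RatFunc ℂ) :=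
  M.map (algebraMap ℂ[X] (RatFunc ℂ))

/-- The value `M(z)` of a polynomial matrix at `z ∈ ℂ`. -/
def evalMatrix {p q : Type*} (z : ℂ) (M : Matrix p q ℂ[X]) : Matrix p q ℂ :=
  M.map (Polynomial.eval z)

/-- The matrix coefficient of `λ ^ k` of a polynomial matrix. -/
def coeffMatrix {p q : Type*} (M : Matrix p q ℂ[X]) (k : ℕ) : Matrix p q ℂ :=
  M.map (fun f => f.coeff k)

/-- Entries of the form `a₁ λ + a₀`. -/
def IsPencil {p q : Type*} (M : Matrix p q ℂ[X]) : Prop :=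
  ∀ i j, (M i j).natDegree ≤ 1

section SystemMatrices

variable {p m n : Type*} [Fintype p] [DecidableEq p] [Fintype m] [Fintype n]

/-- The blocks of `L = [A, -B; C, D]`, partitioned as `(p + m) × (p + n)`. -/
def blockA (L : Matrix (p ⊕ m) (p ⊕ n) ℂ[X]) : Matrix p p ℂ[X] := L.toBlocks₁₁

/-- The block `B`; the upper right block of the pencil is `-B`. -/
def blockB (L : Matrix (p ⊕ m) (p ⊕ n) ℂ[X]) : Matrix p n ℂ[X] := -L.toBlocks₁₂

/-- The block `C`. -/
def blockC (L : Matrix (p ⊕ m) (p ⊕ n) ℂ[X]) : Matrix m p ℂ[X] := L.toBlocks₂₁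

/-- The block `D`. -/
def blockD (L : Matrix (p ⊕ m) (p ⊕ n) ℂ[X]) : Matrix m n ℂ[X] := L.toBlocks₂₂

/-- `L = [A, -B; C, D]` is a linear polynomial system matrix with transfer function matrix `R`:
it is a pencil, `A` is regular, and `R = D + C A⁻¹ B`. -/
structure IsLinearSystemMatrixOf (L : Matrix (p ⊕ m) (p ⊕ n) ℂ[X])
    (R : Matrix m n (RatFunc ℂ)) : Prop where
  pencil : IsPencil L
  regular : (blockA L).det ≠ 0
  transfer : R = toRat (blockD L) + toRat (blockC L) * (toRat (blockA L))⁻¹ * toRat (blockB L)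

/-- `[A, -B]` and `[A; C]` have full row, respectively column, rank at every finite point and at
infinity, where the rank at infinity of a pencil is the rank of its coefficient of `λ`. -/
structure IsStronglyMinimal (L : Matrix (p ⊕ m) (p ⊕ n) ℂ[X]) : Prop where
  row_finite : ∀ z : ℂ,
    (evalMatrix z (Matrix.fromCols (blockA L) (-blockB L))).rank = Fintype.card p
  col_finite : ∀ z : ℂ,
    (evalMatrix z (Matrix.fromRows (blockA L) (blockC L))).rank = Fintype.card p
  row_infinity :
    (coeffMatrix (Matrix.fromCols (blockA L) (-blockB L)) 1).rank = Fintype.card p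
  col_infinity :
    (coeffMatrix (Matrix.fromRows (blockA L) (blockC L)) 1).rank = Fintype.card p

/-- `L` is a strongly minimal linearization of the rational matrix `R`. -/
structure IsStronglyMinimalLinearization (L : Matrix (p ⊕ m) (p ⊕ n) ℂ[X])
    (R : Matrix m n (RatFunc ℂ)) : Prop where
  system : IsLinearSystemMatrixOf L R
  minimal : IsStronglyMinimal L

end SystemMatrices

/-- The coupled pencil
`[A₁, 0, -B₁; 0, A₂, -B₂; C₁, C₂, D₁]` built from
`L₁ = [A₁, -B₁; C₁, D₁]` and `L₂ = [A₂, -B₂; C₂, 0]`. -/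
def coupledPencil {p q m n : Type*} (L₁ : Matrix (p ⊕ m) (p ⊕ n) ℂ[X])
    (L₂ : Matrix (q ⊕ m) (q ⊕ n) ℂ[X]) :
    Matrix ((p ⊕ q) ⊕ m) ((p ⊕ q) ⊕ n) ℂ[X] :=
  Matrix.fromBlocks
    (Matrix.fromBlocks (blockA L₁) 0 0 (blockA L₂))
    (Matrix.fromRows (-blockB L₁) (-blockB L₂))
    (Matrix.fromCols (blockC L₁) (blockC L₂))
    (blockD L₁)

/-- All entries `num / denom` satisfy `deg num < deg denom` (with `deg 0 = -∞`). -/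
def IsStrictlyProper {m n : Type*} (R : Matrix m n (RatFunc ℂ)) : Prop :=
  ∀ i j, (R i j).num.degree < (R i j).denom.degree

/-- `P` is the polynomial part and `Rsp` the strictly proper part of `R`. -/
def IsAdditiveDecomposition {m n : Type*} (R : Matrix m n (RatFunc ℂ))
    (P : Matrix m n ℂ[X]) (Rsp : Matrix m n (RatFunc ℂ)) : Prop :=
  IsStrictlyProper Rsp ∧ R = toRat P + Rsp

/-- A matrix, possibly with differently named row and column indices, that is unitary. -/
def IsUnitary {p q : Type*} [Fintype p] [DecidableEq p] [Fintype q] [DecidableEq q]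
    (U : Matrix p q ℂ) : Prop :=
  Uᴴ * U = 1 ∧ U * Uᴴ = 1

/-! ### The polynomial part -/

section PolynomialPart

variable {m n : ℕ}

/-- The block Hankel matrix with `d - 1` block rows and columns and (counting from zero) block
`P_{2d-2-a-b}` in position `(a, b)`. For `P` of degree at most `d` this block is zero above the
block antidiagonal `a + b = d - 2`, is `P_d` on it, and is `P₂` in the last position. -/
def hankelT (P : Matrix (Fin m) (Fin n) ℂ[X]) (d : ℕ) :
    Matrix (Fin (d - 1) × Fin m) (Fin (d - 1) × Fin n) ℂ :=
  Matrix.of fun x y => coeffMatrix P (2 * d - 2 - x.1.val - y.1.val) x.2 y.2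

/-- The pencil `L_s = [A_s, -B_s; C_s, D_s]`, for `P` of degree at most `d`. In block form, with
blocks counted from zero, `A_s` has blocks `λ P_{2d-1-a-b} - P_{2d-2-a-b}`, `-B_s` has blocks
`λ P_{d-a}`, `C_s` has blocks `λ P_{d-b}` and `D_s = λ P₁ + P₀`. -/
def lancasterPencil (P : Matrix (Fin m) (Fin n) ℂ[X]) (d : ℕ) :
    Matrix ((Fin (d - 1) × Fin m) ⊕ Fin m) ((Fin (d - 1) × Fin n) ⊕ Fin n) ℂ[X] :=
  Matrix.fromBlocks
    (Matrix.of fun x y =>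
      X * C (coeffMatrix P (2 * d - 1 - x.1.val - y.1.val) x.2 y.2)
        - C (coeffMatrix P (2 * d - 2 - x.1.val - y.1.val) x.2 y.2))
    (Matrix.of fun x j => X * C (coeffMatrix P (d - x.1.val) x.2 j))
    (Matrix.of fun i y => X * C (coeffMatrix P (d - y.1.val) i y.2))
    (Matrix.of fun i j => X * C (coeffMatrix P 1 i j) + C (coeffMatrix P 0 i j))

/-- `U = [U₁, U₂]` and `V = [V₁, V₂]` are unitary and `Uᴴ T V = [0, 0; 0, U₂ᴴ T V₂]` with
`U₂ᴴ T V₂` invertible of size `r = rank T`. -/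
structure CompressesLowerRight {p q : Type*} [Fintype p] [DecidableEq p] [Fintype q]
    [DecidableEq q] (T : Matrix p q ℂ) {a b r : ℕ}
    (U₁ : Matrix p (Fin a) ℂ) (U₂ : Matrix p (Fin r) ℂ)
    (V₁ : Matrix q (Fin b) ℂ) (V₂ : Matrix q (Fin r) ℂ) : Prop where
  rank_eq : r = T.rank
  unitary_left : IsUnitary (Matrix.fromCols U₁ U₂)
  unitary_right : IsUnitary (Matrix.fromCols V₁ V₂)
  compress : (Matrix.fromCols U₁ U₂)ᴴ * T * Matrix.fromCols V₁ V₂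
    = Matrix.fromBlocks 0 0 0 (U₂ᴴ * T * V₂)
  invertible : IsUnit (U₂ᴴ * T * V₂)

/-- The compressed pencil `diag(U₂ᴴ, I_m) L_s diag(V₂, I_n)
= [U₂ᴴ A_s V₂, -U₂ᴴ B_s; C_s V₂, D_s]`. -/
def polynomialLinearization (P : Matrix (Fin m) (Fin n) ℂ[X]) (d : ℕ) {r : ℕ}
    (U₂ : Matrix (Fin (d - 1) × Fin m) (Fin r) ℂ) (V₂ : Matrix (Fin (d - 1) × Fin n) (Fin r) ℂ) :
    Matrix (Fin r ⊕ Fin m) (Fin r ⊕ Fin n) ℂ[X] :=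
  (Matrix.fromBlocks (constMatrix U₂ᴴ) 0 0 1 :
      Matrix (Fin r ⊕ Fin m) ((Fin (d - 1) × Fin m) ⊕ Fin m) ℂ[X]) *
    lancasterPencil P d *
    (Matrix.fromBlocks (constMatrix V₂) 0 0 1 :
      Matrix ((Fin (d - 1) × Fin n) ⊕ Fin n) (Fin r ⊕ Fin n) ℂ[X])

end PolynomialPart

/-! ### The strictly proper part -/

section StrictlyProperPart

variable {m n : ℕ}

/-- The coefficient of `λ ^ (-i)` in the Laurent expansion of a rational function at infinity:
substitute `λ = t⁻¹`, expand in `ℂ((t))`, and read the coefficient of `t ^ i`. -/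
def laurentCoeffAtInfinity (r : RatFunc ℂ) (i : ℤ) : ℂ :=
  HahnSeries.coeff
    (RatFunc.eval (HahnSeries.C : ℂ →+* LaurentSeries ℂ) (HahnSeries.single (-1 : ℤ) (1 : ℂ)) r) i

/-- The block Hankel matrix `H`, with `k` block rows and columns and (counting from zero) block
`R_{-(a+b+1)}` in position `(a, b)`. -/
def hankelH (R : Matrix (Fin m) (Fin n) (RatFunc ℂ)) (k : ℕ) :
    Matrix (Fin k × Fin m) (Fin k × Fin n) ℂ :=
  Matrix.of fun x y => laurentCoeffAtInfinity (R x.2 y.2) ((x.1.val : ℤ) + (y.1.val : ℤ) + 1)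

/-- The shifted block Hankel matrix `H_σ`, with block `R_{-(a+b+2)}` in position `(a, b)`. -/
def hankelHShift (R : Matrix (Fin m) (Fin n) (RatFunc ℂ)) (k : ℕ) :
    Matrix (Fin k × Fin m) (Fin k × Fin n) ℂ :=
  Matrix.of fun x y => laurentCoeffAtInfinity (R x.2 y.2) ((x.1.val : ℤ) + (y.1.val : ℤ) + 2)

/-- `diag(ε₀/ψ₀, …, ε_{s-1}/ψ_{s-1}, 0)` is the (global) Smith–McMillan form of `R`. -/
structure IsSmithMcMillanForm (R : Matrix (Fin m) (Fin n) (RatFunc ℂ)) (s : ℕ)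
    (ε ψ : Fin s → ℂ[X]) : Prop where
  le_rows : s ≤ m
  le_cols : s ≤ n
  monic_num : ∀ i, (ε i).Monic
  monic_den : ∀ i, (ψ i).Monic
  coprime : ∀ i, IsCoprime (ε i) (ψ i)
  dvd_num : ∀ i j, i ≤ j → ε i ∣ ε j
  dvd_den : ∀ i j, i ≤ j → ψ j ∣ ψ i
  equivalent : ∃ (M : Matrix (Fin m) (Fin m) ℂ[X]) (N : Matrix (Fin n) (Fin n) ℂ[X]),
    IsUnit M.det ∧ IsUnit N.det ∧
    toRat M * R * toRat N = Matrix.of fun i j =>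
      if h : i.val = j.val ∧ i.val < s then
        algebraMap ℂ[X] (RatFunc ℂ) (ε ⟨i.val, h.2⟩) / algebraMap ℂ[X] (RatFunc ℂ) (ψ ⟨i.val, h.2⟩)
      else 0

/-- The total polar degree of the finite poles of `R` is `ν`: the sum of the degrees of the
denominators in the Smith–McMillan form. -/
def HasFinitePolarDegree (R : Matrix (Fin m) (Fin n) (RatFunc ℂ)) (ν : ℕ) : Prop :=
  ∃ (s : ℕ) (ε ψ : Fin s → ℂ[X]), IsSmithMcMillanForm R s ε ψ ∧ ν = ∑ i, (ψ i).natDegree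

/-- `U = [U₁, U₂]` and `V = [V₁, V₂]` are unitary and `Uᴴ H V = [U₁ᴴ H V₁, 0; 0, 0]` with
`U₁ᴴ H V₁` invertible of size `r = rank H`. -/
structure CompressesUpperLeft {p q : Type*} [Fintype p] [DecidableEq p] [Fintype q]
    [DecidableEq q] (H : Matrix p q ℂ) {a b r : ℕ}
    (U₁ : Matrix p (Fin r) ℂ) (U₂ : Matrix p (Fin a) ℂ)
    (V₁ : Matrix q (Fin r) ℂ) (V₂ : Matrix q (Fin b) ℂ) : Prop where
  rank_eq : r = H.rank
  unitary_left : IsUnitary (Matrix.fromCols U₁ U₂)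
  unitary_right : IsUnitary (Matrix.fromCols V₁ V₂)
  compress : (Matrix.fromCols U₁ U₂)ᴴ * H * Matrix.fromCols V₁ V₂
    = Matrix.fromBlocks (U₁ᴴ * H * V₁) 0 0 0
  invertible : IsUnit (U₁ᴴ * H * V₁)

/-- The first block (of `m` rows) of a matrix with `k > 0` blocks of rows. -/
def firstBlock {k r : ℕ} (hk : 0 < k) (U : Matrix (Fin k × Fin m) (Fin r) ℂ) :
    Matrix (Fin m) (Fin r) ℂ :=
  Matrix.of fun i j => U (⟨0, hk⟩, i) j

/-- The pencil `[U₁ᴴ H_σ V₁ - λ Ĥ, Ĥ V₁₁ᴴ; U₁₁ Ĥ, 0]`, where `Ĥ = U₁ᴴ H V₁` and `U₁₁`, `V₁₁` are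
the first `m` rows of `U₁` and the first `n` rows of `V₁`. -/
def strictlyProperLinearization (R : Matrix (Fin m) (Fin n) (RatFunc ℂ)) {k r : ℕ} (hk : 0 < k)
    (U₁ : Matrix (Fin k × Fin m) (Fin r) ℂ) (V₁ : Matrix (Fin k × Fin n) (Fin r) ℂ) :
    Matrix (Fin r ⊕ Fin m) (Fin r ⊕ Fin n) ℂ[X] :=
  Matrix.fromBlocks
    (constMatrix (U₁ᴴ * hankelHShift R k * V₁) - (X : ℂ[X]) • constMatrix (U₁ᴴ * hankelH R k * V₁))
    (constMatrix (U₁ᴴ * hankelH R k * V₁ * (firstBlock hk V₁)ᴴ))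
    (constMatrix (firstBlock hk U₁ * (U₁ᴴ * hankelH R k * V₁)))
    0

end StrictlyProperPart

end RationalLinearization

end

open RationalLinearization

namespace RationalLinearization

/-! ### Laurent expansions at infinity -/

/-! Expansion at infinity is an injective ring homomorphism `laurentHom` into `ℂ((t))`, `t = λ⁻¹`,
so rational identities can be checked coefficientwise. Division with remainder gives the additive
decomposition, and the coefficients at nonnegative powers of `λ` make it unique.

Polynomial part. Write `A_s = λS - T` and let `K` be the block column with `-B_s = λK`. Then `[S K]
= [0 T]`: the Hankel blocks shift by one column. From `x(zS - T) = 0` one gets `xT = 0` block by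
block, so at every finite `z` the left kernel of the pencil lies in that of `T`. Conversely the
kernels of `T` lie in those of `S`, `K` and `C_s`, so compressing to `V₂V₂ᴴ` and `U₂U₂ᴴ` loses
nothing. Hence the compressed leading block is invertible at every finite point, and at infinity `xS
= 0`, `xK = 0` again force `xT = 0`. The transfer function comes from an explicit polynomial
solution of `A_s W = B_s` (`leading_mul_powerColumn`, `coeffRow_mul_powerColumn_add`).

Strictly proper part. The quotient of `ℂ[λ]ⁿ` by the vectors that `R` maps to polynomial vectors is
`⊕ ℂ[λ]/(ψᵢ)`, with `ψᵢ` the Smith–McMillan denominators. Its dimension is the polar degree, and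
multiplication by `λ` on it is the state matrix of an observable and reachable realization
(`exists_isRealization_of_ker`, `HasFinitePolarDegree.exists_isRealization`). So `H = OQ` and `H_σ =
OFQ` with `O` and `Q` the observability and reachability matrices, and large Hankel matrices have
rank the polar degree. When the rank equals this dimension, `QV₁'` is an invertible change of state
basis, and `L_sp` is the transformed realization with its state equation multiplied by `Ĥ`
(`IsRealization.strictlyProperLinearization`). Its strong minimality at finite points is the
eigenvector test for observability and reachability.

Coupling. The first leading block is singular at no finite point and the second is not singular at
infinity. At each point, one component of a kernel vector vanishes for this reason and the other by
minimality of its own pencil. -/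

lemma coeff_eval₂_single_neg (p : ℂ[X]) (j : ℕ) :
    (p.eval₂ (HahnSeries.C : ℂ →+* LaurentSeries ℂ) (HahnSeries.single (-1 : ℤ) (1 : ℂ))).coeff
      (-(j : ℤ)) = p.coeff j := by
  induction p using Polynomial.induction_on' with
  | add p q hp hq => simp [hp, hq, eval₂_add]
  | monomial k a =>
    simp only [eval₂_monomial, HahnSeries.single_pow, coeff_monomial,
      HahnSeries.C_mul_eq_smul, HahnSeries.coeff_smul, HahnSeries.coeff_single]
    by_cases h : k = j
    · simp [h]
    · have : (-(j : ℤ)) ≠ k • (-1 : ℤ) := by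
        simp only [nsmul_eq_mul]; omega
      rw [if_neg this, if_neg h]; simp

lemma coeff_eval₂_single_of_pos (p : ℂ[X]) (i : ℤ) (hi : 0 < i) :
    (p.eval₂ (HahnSeries.C : ℂ →+* LaurentSeries ℂ) (HahnSeries.single (-1 : ℤ) (1 : ℂ))).coeff
      i = 0 := by
  induction p using Polynomial.induction_on' with
  | add p q hp hq => simp [hp, hq, eval₂_add]
  | monomial k a =>
    simp only [eval₂_monomial, HahnSeries.single_pow,
      HahnSeries.C_mul_eq_smul, HahnSeries.coeff_smul, HahnSeries.coeff_single]
    have : i ≠ k • (-1 : ℤ) := by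
      simp only [nsmul_eq_mul]; omega
    rw [if_neg this]; simp

lemma eval₂_single_ne_zero {p : ℂ[X]} (hp : p ≠ 0) :
    p.eval₂ (HahnSeries.C : ℂ →+* LaurentSeries ℂ) (HahnSeries.single (-1 : ℤ) (1 : ℂ)) ≠ 0 := by
  intro h
  apply hp
  ext j
  rw [← coeff_eval₂_single_neg, h]; simp

/-- Under `λ = t⁻¹` the leading term of a polynomial becomes its lowest power of `t`. -/
lemma order_eval₂_single {p : ℂ[X]} (hp : p ≠ 0) :
    (p.eval₂ (HahnSeries.C : ℂ →+* LaurentSeries ℂ) (HahnSeries.single (-1 : ℤ) (1 : ℂ))).order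
      = -(p.natDegree : ℤ) := by
  set g := p.eval₂ (HahnSeries.C : ℂ →+* LaurentSeries ℂ) (HahnSeries.single (-1 : ℤ) (1 : ℂ))
    with hg
  apply le_antisymm
  · apply HahnSeries.order_le_of_coeff_ne_zero
    rw [hg, coeff_eval₂_single_neg]
    simpa using hp
  · have h := HahnSeries.coeff_order_eq_zero.not.2 (eval₂_single_ne_zero hp)
    rw [← hg] at h
    rcases lt_or_ge 0 g.order with h0 | h0
    · omega
    · obtain ⟨j, hj⟩ := Int.exists_eq_neg_ofNat h0
      rw [hj, hg, coeff_eval₂_single_neg] at h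
      have := le_natDegree_of_ne_zero h
      omega

lemma nonZeroDivisors_le_comap_eval₂_single :
    nonZeroDivisors ℂ[X] ≤ (nonZeroDivisors (LaurentSeries ℂ)).comap
      (eval₂RingHom (HahnSeries.C : ℂ →+* LaurentSeries ℂ)
        (HahnSeries.single (-1 : ℤ) (1 : ℂ))) :=
  fun _ hp => mem_nonZeroDivisors_of_ne_zero (eval₂_single_ne_zero (nonZeroDivisors.ne_zero hp))

/-- Expansion at infinity, as a ring homomorphism. -/
noncomputable def laurentHom : RatFunc ℂ →+* LaurentSeries ℂ :=
  RatFunc.liftRingHom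
    (eval₂RingHom (HahnSeries.C : ℂ →+* LaurentSeries ℂ) (HahnSeries.single (-1 : ℤ) (1 : ℂ)))
    nonZeroDivisors_le_comap_eval₂_single

lemma laurentCoeffAtInfinity_eq (f : RatFunc ℂ) (i : ℤ) :
    laurentCoeffAtInfinity f i = (laurentHom f).coeff i := by
  rw [laurentCoeffAtInfinity, laurentHom, RatFunc.liftRingHom_apply]
  rfl

lemma laurentHom_algebraMap (p : ℂ[X]) :
    laurentHom (algebraMap ℂ[X] (RatFunc ℂ) p) =
      p.eval₂ (HahnSeries.C : ℂ →+* LaurentSeries ℂ) (HahnSeries.single (-1 : ℤ) (1 : ℂ)) := by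
  simp [laurentHom]

@[simp] lemma laurentCoeffAtInfinity_add (f g : RatFunc ℂ) (i : ℤ) :
    laurentCoeffAtInfinity (f + g) i = laurentCoeffAtInfinity f i + laurentCoeffAtInfinity g i := by
  simp [laurentCoeffAtInfinity_eq]

@[simp] lemma laurentCoeffAtInfinity_zero (i : ℤ) : laurentCoeffAtInfinity 0 i = 0 := by
  simp [laurentCoeffAtInfinity_eq]

@[simp] lemma laurentCoeffAtInfinity_sum {ι : Type*} (s : Finset ι) (f : ι → RatFunc ℂ) (i : ℤ) :
    laurentCoeffAtInfinity (∑ j ∈ s, f j) i = ∑ j ∈ s, laurentCoeffAtInfinity (f j) i := by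
  classical
  induction s using Finset.induction_on with
  | empty => simp
  | insert a s ha ih => simp [Finset.sum_insert ha, ih]

lemma laurentCoeffAtInfinity_C_mul (c : ℂ) (f : RatFunc ℂ) (i : ℤ) :
    laurentCoeffAtInfinity (algebraMap ℂ[X] (RatFunc ℂ) (C c) * f) i =
      c * laurentCoeffAtInfinity f i := by
  simp only [laurentCoeffAtInfinity_eq, map_mul, laurentHom_algebraMap, eval₂_C,
    HahnSeries.C_mul_eq_smul, HahnSeries.coeff_smul, smul_eq_mul]

lemma laurentCoeffAtInfinity_X_mul (f : RatFunc ℂ) (i : ℤ) :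
    laurentCoeffAtInfinity (algebraMap ℂ[X] (RatFunc ℂ) X * f) i =
      laurentCoeffAtInfinity f (i + 1) := by
  simp only [laurentCoeffAtInfinity_eq, map_mul, laurentHom_algebraMap, eval₂_X]
  have := HahnSeries.coeff_single_mul_add (r := (1 : ℂ)) (x := laurentHom f) (a := i + 1)
    (b := (-1 : ℤ))
  simpa using this

lemma laurentCoeffAtInfinity_algebraMap_neg (p : ℂ[X]) (j : ℕ) :
    laurentCoeffAtInfinity (algebraMap ℂ[X] (RatFunc ℂ) p) (-(j : ℤ)) = p.coeff j := by
  rw [laurentCoeffAtInfinity_eq, laurentHom_algebraMap, coeff_eval₂_single_neg]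

lemma laurentCoeffAtInfinity_algebraMap_pos (p : ℂ[X]) {i : ℤ} (hi : 0 < i) :
    laurentCoeffAtInfinity (algebraMap ℂ[X] (RatFunc ℂ) p) i = 0 := by
  rw [laurentCoeffAtInfinity_eq, laurentHom_algebraMap, coeff_eval₂_single_of_pos _ _ hi]

lemma ratFunc_ext_laurent {f g : RatFunc ℂ}
    (h : ∀ i, laurentCoeffAtInfinity f i = laurentCoeffAtInfinity g i) : f = g := by
  apply laurentHom.injective
  ext i
  rw [← laurentCoeffAtInfinity_eq, ← laurentCoeffAtInfinity_eq, h]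

lemma exists_laurentCoeffAtInfinity_eq_zero (f : RatFunc ℂ) :
    ∃ N : ℤ, ∀ i < N, laurentCoeffAtInfinity f i = 0 :=
  ⟨(laurentHom f).order, fun i hi => by
    rw [laurentCoeffAtInfinity_eq, HahnSeries.coeff_eq_zero_of_lt_order hi]⟩

lemma laurentCoeffAtInfinity_of_degree_lt {p q : ℂ[X]} (h : p.degree < q.degree) {i : ℤ}
    (hi : i ≤ 0) :
    laurentCoeffAtInfinity
      (algebraMap ℂ[X] (RatFunc ℂ) p / algebraMap ℂ[X] (RatFunc ℂ) q) i = 0 := by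
  have hq : q ≠ 0 := by rintro rfl; simp at h
  by_cases hp : p = 0
  · simp [hp]
  rw [laurentCoeffAtInfinity_eq]
  apply HahnSeries.coeff_eq_zero_of_lt_order
  set f := algebraMap ℂ[X] (RatFunc ℂ) p / algebraMap ℂ[X] (RatFunc ℂ) q with hf
  have hq' : algebraMap ℂ[X] (RatFunc ℂ) q ≠ 0 := RatFunc.algebraMap_ne_zero hq
  have hf0 : f ≠ 0 := div_ne_zero (RatFunc.algebraMap_ne_zero hp) hq'
  have hm : laurentHom f * laurentHom (algebraMap ℂ[X] (RatFunc ℂ) q) =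
      laurentHom (algebraMap ℂ[X] (RatFunc ℂ) p) := by
    rw [← map_mul, hf, div_mul_cancel₀ _ hq']
  have ho := congrArg HahnSeries.order hm
  rw [HahnSeries.order_mul (by simpa using hf0) (by simpa using hq), laurentHom_algebraMap,
    laurentHom_algebraMap, order_eval₂_single hp, order_eval₂_single hq] at ho
  have := natDegree_lt_natDegree hp h
  omega

lemma IsStrictlyProper.laurentCoeffAtInfinity_eq_zero {m n : Type*} {R : Matrix m n (RatFunc ℂ)}
    (hR : IsStrictlyProper R) (i : m) (j : n) {l : ℤ} (hl : l ≤ 0) :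
    laurentCoeffAtInfinity (R i j) l = 0 := by
  rw [← RatFunc.num_div_denom (R i j)]
  exact laurentCoeffAtInfinity_of_degree_lt (hR i j) hl

/-- Division with remainder splits off the polynomial part of a rational function. -/
lemma exists_polynomial_add_strictlyProper (f : RatFunc ℂ) :
    ∃ (p : ℂ[X]) (g : RatFunc ℂ), g.num.degree < g.denom.degree ∧
      f = algebraMap ℂ[X] (RatFunc ℂ) p + g := by
  have hd : f.denom ≠ 0 := f.denom_ne_zero
  have hd' : algebraMap ℂ[X] (RatFunc ℂ) f.denom ≠ 0 := RatFunc.algebraMap_ne_zero hd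
  set r := f.num % f.denom with hr
  set g := algebraMap ℂ[X] (RatFunc ℂ) r / algebraMap ℂ[X] (RatFunc ℂ) f.denom with hg
  refine ⟨f.num / f.denom, g, ?_, ?_⟩
  · have hdeg : r.degree < f.denom.degree := EuclideanDomain.mod_lt _ hd
    -- Strict properness refers to the reduced fraction of `g`, while `r / f.denom` need not be
    -- reduced; cross-multiplying carries the degree inequality over.
    have h1 : g.num * f.denom = r * g.denom := (RatFunc.num_mul_eq_mul_denom_iff hd).2 hg
    by_cases h0 : g = 0
    · rw [h0]; simp
    have hgn : g.num ≠ 0 := by simpa using h0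
    have h2 := congrArg Polynomial.degree h1
    rw [degree_mul, degree_mul, degree_eq_natDegree hgn, degree_eq_natDegree hd,
      degree_eq_natDegree g.denom_ne_zero] at h2
    have hr0 : r ≠ 0 := by
      intro h; apply h0; rw [hg, h]; simp
    rw [degree_eq_natDegree hr0, degree_eq_natDegree hd] at hdeg
    rw [degree_eq_natDegree hr0] at h2
    rw [degree_eq_natDegree hgn, degree_eq_natDegree g.denom_ne_zero]
    norm_cast at *
    omega
  · conv_lhs => rw [← RatFunc.num_div_denom f]
    rw [hg, div_eq_iff hd', add_mul, div_mul_cancel₀ _ hd', ← map_mul, ← map_add, hr, mul_comm,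
      EuclideanDomain.div_add_mod]

/-- A strictly proper part whose coefficients at negative powers of `λ` all vanish has zero
expansion. This makes "`R u` is polynomial" a condition on Laurent coefficients. -/
lemma exists_algebraMap_eq_iff (f : RatFunc ℂ) :
    (∃ p : ℂ[X], algebraMap ℂ[X] (RatFunc ℂ) p = f) ↔
      ∀ a : ℕ, laurentCoeffAtInfinity f ((a : ℤ) + 1) = 0 := by
  constructor
  · rintro ⟨p, rfl⟩ a
    exact laurentCoeffAtInfinity_algebraMap_pos p (by omega)
  · intro h
    obtain ⟨p, g, hg, rfl⟩ := exists_polynomial_add_strictlyProper f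
    refine ⟨p, ?_⟩
    suffices g = 0 by simp [this]
    apply ratFunc_ext_laurent
    intro i
    rcases le_or_gt i 0 with hi | hi
    · rw [← RatFunc.num_div_denom g, laurentCoeffAtInfinity_of_degree_lt hg hi]; simp
    · obtain ⟨a, rfl⟩ : ∃ a : ℕ, i = a + 1 := ⟨(i - 1).toNat, by omega⟩
      have := h a
      rw [laurentCoeffAtInfinity_add, laurentCoeffAtInfinity_algebraMap_pos p hi, zero_add] at this
      simpa using this

theorem existsUnique_additiveDecomposition {m n : ℕ} (R : Matrix (Fin m) (Fin n) (RatFunc ℂ)) :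
    ∃! S : Matrix (Fin m) (Fin n) ℂ[X] × Matrix (Fin m) (Fin n) (RatFunc ℂ),
      IsAdditiveDecomposition R S.1 S.2 := by
  choose P Q hQ hPQ using fun i j => exists_polynomial_add_strictlyProper (R i j)
  refine ⟨(Matrix.of P, Matrix.of Q), ⟨hQ, by ext i j; exact hPQ i j⟩, ?_⟩
  rintro ⟨P', Q'⟩ ⟨hQ', h'⟩
  have hP : P' = Matrix.of P := by
    ext i j a
    have e : algebraMap ℂ[X] (RatFunc ℂ) (P' i j) + Q' i j =
        algebraMap ℂ[X] (RatFunc ℂ) (P i j) + Q i j := by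
      rw [← hPQ, h']; rfl
    -- The coefficient of `λ ^ a` with `a ≥ 0` does not see the strictly proper parts.
    have := congrArg (fun f => laurentCoeffAtInfinity f (-(a : ℤ))) e
    simp only [laurentCoeffAtInfinity_add, laurentCoeffAtInfinity_algebraMap_neg] at this
    rw [hQ'.laurentCoeffAtInfinity_eq_zero i j (by omega)] at this
    have h2 := IsStrictlyProper.laurentCoeffAtInfinity_eq_zero (R := Matrix.of Q) hQ i j
      (l := -(a : ℤ)) (by omega)
    simp only [Matrix.of_apply] at h2
    rw [h2] at this
    simpa using this
  refine Prod.ext hP ?_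
  have h1 : toRat P' + Q' = toRat (Matrix.of P) + Matrix.of Q := by
    rw [← h']; ext i j; exact hPQ i j
  change P' = _ at hP
  rw [hP] at h1
  exact add_left_cancel h1

/-! ### Coefficients, values and ranks of polynomial matrices -/

section MatrixMaps

variable {p q s t : Type*}

lemma toRat_mul [Fintype q] (M : Matrix p q ℂ[X]) (N : Matrix q s ℂ[X]) :
    toRat (M * N) = toRat M * toRat N := Matrix.map_mul

lemma toRat_add (M N : Matrix p q ℂ[X]) : toRat (M + N) = toRat M + toRat N := by
  ext i j; simp [toRat]

lemma toRat_neg (M : Matrix p q ℂ[X]) : toRat (-M) = -toRat M := by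
  ext i j; simp [toRat]

lemma toRat_zero : toRat (0 : Matrix p q ℂ[X]) = 0 := by
  ext i j; simp [toRat]

lemma toRat_one [DecidableEq p] : toRat (1 : Matrix p p ℂ[X]) = 1 := by
  simp [toRat]

lemma det_toRat [Fintype p] [DecidableEq p] (M : Matrix p p ℂ[X]) :
    (toRat M).det = algebraMap ℂ[X] (RatFunc ℂ) M.det :=
  (RingHom.map_det (algebraMap ℂ[X] (RatFunc ℂ)) M).symm

lemma isUnit_det_toRat [Fintype p] [DecidableEq p] {M : Matrix p p ℂ[X]} (h : M.det ≠ 0) :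
    IsUnit (toRat M).det := by
  rw [det_toRat, isUnit_iff_ne_zero]
  exact RatFunc.algebraMap_ne_zero h

lemma constMatrix_mul [Fintype q] (M : Matrix p q ℂ) (N : Matrix q s ℂ) :
    constMatrix (M * N) = constMatrix M * constMatrix N := Matrix.map_mul

lemma det_constMatrix [Fintype p] [DecidableEq p] (M : Matrix p p ℂ) :
    (constMatrix M).det = C M.det :=
  (RingHom.map_det (C : ℂ →+* ℂ[X]) M).symm

@[simp] lemma evalMatrix_constMatrix (z : ℂ) (M : Matrix p q ℂ) :
    evalMatrix z (constMatrix M) = M := by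
  ext i j; simp [evalMatrix, constMatrix]

@[simp] lemma evalMatrix_sub (z : ℂ) (M N : Matrix p q ℂ[X]) :
    evalMatrix z (M - N) = evalMatrix z M - evalMatrix z N := by
  ext i j; simp [evalMatrix]

@[simp] lemma evalMatrix_X_smul (z : ℂ) (M : Matrix p q ℂ[X]) :
    evalMatrix z ((X : ℂ[X]) • M) = z • evalMatrix z M := by
  ext i j; simp [evalMatrix]

@[simp] lemma evalMatrix_zero (z : ℂ) : evalMatrix z (0 : Matrix p q ℂ[X]) = 0 := by
  ext i j; simp [evalMatrix]

lemma evalMatrix_fromCols (z : ℂ) (M : Matrix p q ℂ[X]) (N : Matrix p s ℂ[X]) :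
    evalMatrix z (Matrix.fromCols M N) = Matrix.fromCols (evalMatrix z M) (evalMatrix z N) := by
  ext i (j | j) <;> rfl

lemma evalMatrix_fromRows (z : ℂ) (M : Matrix p q ℂ[X]) (N : Matrix s q ℂ[X]) :
    evalMatrix z (Matrix.fromRows M N) = Matrix.fromRows (evalMatrix z M) (evalMatrix z N) := by
  ext (i | i) j <;> rfl

lemma evalMatrix_fromBlocks (z : ℂ) (K : Matrix p q ℂ[X]) (L : Matrix p s ℂ[X])
    (M : Matrix t q ℂ[X]) (N : Matrix t s ℂ[X]) :
    evalMatrix z (Matrix.fromBlocks K L M N) = Matrix.fromBlocks (evalMatrix z K)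
      (evalMatrix z L) (evalMatrix z M) (evalMatrix z N) := by
  ext (i | i) (j | j) <;> rfl

lemma evalMatrix_det [Fintype p] [DecidableEq p] (z : ℂ) (M : Matrix p p ℂ[X]) :
    (evalMatrix z M).det = M.det.eval z :=
  (RingHom.map_det (evalRingHom z) M).symm

lemma coeffMatrix_fromCols (k : ℕ) (M : Matrix p q ℂ[X]) (N : Matrix p s ℂ[X]) :
    coeffMatrix (Matrix.fromCols M N) k = Matrix.fromCols (coeffMatrix M k) (coeffMatrix N k) := by
  ext i (j | j) <;> rfl

lemma coeffMatrix_fromRows (k : ℕ) (M : Matrix p q ℂ[X]) (N : Matrix s q ℂ[X]) :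
    coeffMatrix (Matrix.fromRows M N) k = Matrix.fromRows (coeffMatrix M k) (coeffMatrix N k) := by
  ext (i | i) j <;> rfl

lemma coeffMatrix_fromBlocks (k : ℕ) (K : Matrix p q ℂ[X]) (L : Matrix p s ℂ[X])
    (M : Matrix t q ℂ[X]) (N : Matrix t s ℂ[X]) :
    coeffMatrix (Matrix.fromBlocks K L M N) k = Matrix.fromBlocks (coeffMatrix K k)
      (coeffMatrix L k) (coeffMatrix M k) (coeffMatrix N k) := by
  ext (i | i) (j | j) <;> rfl

@[simp] lemma coeffMatrix_zero (k : ℕ) : coeffMatrix (0 : Matrix p q ℂ[X]) k = 0 := by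
  ext i j; simp [coeffMatrix]

@[simp] lemma coeffMatrix_sub (M N : Matrix p q ℂ[X]) (k : ℕ) :
    coeffMatrix (M - N) k = coeffMatrix M k - coeffMatrix N k := by
  ext i j; simp [coeffMatrix]

@[simp] lemma coeffMatrix_constMatrix_one (M : Matrix p q ℂ) :
    coeffMatrix (constMatrix M) 1 = 0 := by
  ext i j; simp [coeffMatrix, constMatrix]

@[simp] lemma coeffMatrix_X_smul_constMatrix_one (M : Matrix p q ℂ) :
    coeffMatrix ((X : ℂ[X]) • constMatrix M) 1 = M := by
  ext i j; simp [coeffMatrix, constMatrix]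

end MatrixMaps

/-! ### Full rank as triviality of kernels -/

section Rank

lemma sumElim_eq_zero_iff {s t : Type*} (u : s → ℂ) (v : t → ℂ) :
    Sum.elim u v = 0 ↔ u = 0 ∧ v = 0 := by
  simp [funext_iff]

variable {p q : Type*} [Fintype p] [Fintype q]

lemma rank_eq_card_rows_iff (M : Matrix p q ℂ) :
    M.rank = Fintype.card p ↔ ∀ x, x ᵥ* M = 0 → x = 0 := by
  rw [Matrix.rank_eq_finrank_span_row]
  have h1 : (∀ x, x ᵥ* M = 0 → x = 0) ↔ LinearIndependent ℂ M.row := by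
    rw [← Matrix.vecMul_injective_iff]
    exact (injective_iff_map_eq_zero (Matrix.vecMulLinear M)).symm
  rw [h1, linearIndependent_iff_card_eq_finrank_span]
  exact eq_comm

lemma rank_eq_card_cols_iff (M : Matrix q p ℂ) :
    M.rank = Fintype.card p ↔ ∀ x, M *ᵥ x = 0 → x = 0 := by
  rw [← Matrix.rank_transpose, rank_eq_card_rows_iff]
  simp [Matrix.vecMul_transpose]

variable [DecidableEq p]

lemma isUnit_of_vecMul_eq_zero {M : Matrix p p ℂ} (h : ∀ x, x ᵥ* M = 0 → x = 0) : IsUnit M :=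
  Matrix.vecMul_injective_iff_isUnit.1
    ((injective_iff_map_eq_zero (Matrix.vecMulLinear M)).2 h)

lemma eq_zero_of_vecMul_eq_zero {M : Matrix p p ℂ} (hM : IsUnit M) {x : p → ℂ}
    (h : x ᵥ* M = 0) : x = 0 :=
  (injective_iff_map_eq_zero (Matrix.vecMulLinear M)).1
    (Matrix.vecMul_injective_iff_isUnit.2 hM) x h

lemma eq_zero_of_mulVec_eq_zero {M : Matrix p p ℂ} (hM : IsUnit M) {x : p → ℂ}
    (h : M *ᵥ x = 0) : x = 0 :=
  (injective_iff_map_eq_zero (Matrix.mulVecLin M)).1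
    (Matrix.mulVec_injective_iff_isUnit.2 hM) x h

end Rank

/-! ### Strong minimality and the coupling of two pencils -/

section StronglyMinimal

variable {p q m n : Type*} [Fintype p] [DecidableEq p] [Fintype q] [DecidableEq q]
  [Fintype m] [Fintype n]

omit [DecidableEq p] in
/-- Strong minimality, with the rank conditions read as injectivity. -/
lemma isStronglyMinimal_iff (L : Matrix (p ⊕ m) (p ⊕ n) ℂ[X]) :
    IsStronglyMinimal L ↔
      (∀ z x, x ᵥ* evalMatrix z (blockA L) = 0 → x ᵥ* evalMatrix z (-blockB L) = 0 → x = 0) ∧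
      (∀ z x, evalMatrix z (blockA L) *ᵥ x = 0 → evalMatrix z (blockC L) *ᵥ x = 0 → x = 0) ∧
      (∀ x, x ᵥ* coeffMatrix (blockA L) 1 = 0 → x ᵥ* coeffMatrix (-blockB L) 1 = 0 → x = 0) ∧
      (∀ x, coeffMatrix (blockA L) 1 *ᵥ x = 0 → coeffMatrix (blockC L) 1 *ᵥ x = 0 → x = 0) := by
  have e1 (M : Matrix p p ℂ) (N : Matrix p n ℂ) :
      (Matrix.fromCols M N).rank = Fintype.card p ↔
        ∀ x, x ᵥ* M = 0 → x ᵥ* N = 0 → x = 0 := by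
    rw [rank_eq_card_rows_iff]
    simp [Matrix.vecMul_fromCols, sumElim_eq_zero_iff]
  have e2 (M : Matrix p p ℂ) (N : Matrix m p ℂ) :
      (Matrix.fromRows M N).rank = Fintype.card p ↔
        ∀ x, M *ᵥ x = 0 → N *ᵥ x = 0 → x = 0 := by
    rw [rank_eq_card_cols_iff]
    simp [Matrix.fromRows_mulVec, sumElim_eq_zero_iff]
  constructor
  · rintro ⟨h1, h2, h3, h4⟩
    simp only [evalMatrix_fromCols, evalMatrix_fromRows, coeffMatrix_fromCols,
      coeffMatrix_fromRows, e1, e2] at h1 h2 h3 h4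
    exact ⟨h1, h2, h3, h4⟩
  · rintro ⟨h1, h2, h3, h4⟩
    constructor <;>
      simp only [evalMatrix_fromCols, evalMatrix_fromRows, coeffMatrix_fromCols,
      coeffMatrix_fromRows, e1, e2] <;> assumption

/-- Two strongly minimal linearizations, the first with no finite and the second with no infinite
eigenvalues in the leading block, couple to one of the sum of the transfer functions. -/
theorem IsStronglyMinimalLinearization.coupledPencil
    {L₁ : Matrix (p ⊕ m) (p ⊕ n) ℂ[X]} {L₂ : Matrix (q ⊕ m) (q ⊕ n) ℂ[X]}
    {R₁ R₂ : Matrix m n (RatFunc ℂ)} (h₁ : IsStronglyMinimalLinearization L₁ R₁)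
    (h₂ : IsStronglyMinimalLinearization L₂ R₂) (hD : blockD L₂ = 0)
    (hA₁ : ∀ z, IsUnit (evalMatrix z (blockA L₁))) (hA₂ : IsUnit (coeffMatrix (blockA L₂) 1)) :
    IsStronglyMinimalLinearization (coupledPencil L₁ L₂) (R₁ + R₂) := by
  have eA : blockA (RationalLinearization.coupledPencil L₁ L₂) =
    Matrix.fromBlocks (blockA L₁) 0 0 (blockA L₂) := rfl
  have eB : -blockB (RationalLinearization.coupledPencil L₁ L₂) =
    Matrix.fromRows (-blockB L₁) (-blockB L₂) := neg_neg _
  have eB' : blockB (RationalLinearization.coupledPencil L₁ L₂) =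
    Matrix.fromRows (blockB L₁) (blockB L₂) := by
      rw [← neg_inj, eB]; ext (i | i) j <;> rfl
  have eC : blockC (RationalLinearization.coupledPencil L₁ L₂) =
    Matrix.fromCols (blockC L₁) (blockC L₂) := rfl
  have eD : blockD (RationalLinearization.coupledPencil L₁ L₂) = blockD L₁ := rfl
  have p₁ := h₁.system.pencil
  have p₂ := h₂.system.pencil
  obtain ⟨r₁, c₁, ri₁, ci₁⟩ := (isStronglyMinimal_iff L₁).1 h₁.minimal
  obtain ⟨r₂, c₂, ri₂, ci₂⟩ := (isStronglyMinimal_iff L₂).1 h₂.minimal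
  have hx (x : p ⊕ q → ℂ) : ∃ u v, x = Sum.elim u v :=
    ⟨x ∘ Sum.inl, x ∘ Sum.inr, (Sum.elim_comp_inl_inr x).symm⟩
  refine ⟨⟨?_, ?_, ?_⟩, (isStronglyMinimal_iff _).2 ⟨?_, ?_, ?_, ?_⟩⟩
  · rintro ((i | i) | i) ((j | j) | j)
    · exact p₁ (.inl i) (.inl j)
    · exact (natDegree_zero (R := ℂ)).trans_le zero_le_one
    · exact (congrArg natDegree (neg_neg _)).trans_le (p₁ (.inl i) (.inr j))
    · exact (natDegree_zero (R := ℂ)).trans_le zero_le_one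
    · exact p₂ (.inl i) (.inl j)
    · exact (congrArg natDegree (neg_neg _)).trans_le (p₂ (.inl i) (.inr j))
    · exact p₁ (.inr i) (.inl j)
    · exact p₂ (.inr i) (.inl j)
    · exact p₁ (.inr i) (.inr j)
  · rw [eA, Matrix.det_fromBlocks_zero₂₁]
    exact mul_ne_zero h₁.system.regular h₂.system.regular
  · have t₁ := h₁.system.transfer
    have t₂ := h₂.system.transfer
    have u₁ := isUnit_det_toRat h₁.system.regular
    have u₂ := isUnit_det_toRat h₂.system.regular
    have hinv : (toRat (Matrix.fromBlocks (blockA L₁) 0 0 (blockA L₂)))⁻¹ =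
        Matrix.fromBlocks (toRat (blockA L₁))⁻¹ 0 0 (toRat (blockA L₂))⁻¹ := by
      apply Matrix.inv_eq_right_inv
      have : toRat (Matrix.fromBlocks (blockA L₁) 0 0 (blockA L₂)) =
          Matrix.fromBlocks (toRat (blockA L₁)) 0 0 (toRat (blockA L₂)) := by
        rw [toRat, Matrix.fromBlocks_map]; simp [toRat]
      rw [this, Matrix.fromBlocks_multiply]
      simp [Matrix.mul_nonsing_inv _ u₁, Matrix.mul_nonsing_inv _ u₂]
    have hC : toRat (Matrix.fromCols (blockC L₁) (blockC L₂)) =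
        Matrix.fromCols (toRat (blockC L₁)) (toRat (blockC L₂)) := by
      ext i (j | j) <;> rfl
    have hB : toRat (Matrix.fromRows (blockB L₁) (blockB L₂)) =
        Matrix.fromRows (toRat (blockB L₁)) (toRat (blockB L₂)) := by
      ext (i | i) j <;> rfl
    rw [eA, eB', eC, eD, hinv, hC, hB, t₁, t₂, hD, toRat_zero, zero_add,
      Matrix.fromCols_mul_fromBlocks, Matrix.fromCols_mul_fromRows]
    simp [add_assoc]
  · intro z x h h'
    obtain ⟨u, v, rfl⟩ := hx x
    rw [eA, evalMatrix_fromBlocks, Matrix.vecMul_fromBlocks] at h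
    rw [eB, evalMatrix_fromRows, Matrix.sumElim_vecMul_fromRows] at h'
    simp only [Sum.elim_comp_inl, Sum.elim_comp_inr, evalMatrix_zero, Matrix.vecMul_zero,
      add_zero, zero_add, sumElim_eq_zero_iff] at h
    -- At a finite point the first component dies because `A₁(z)` is invertible, which leaves the
    -- minimality of `L₂` for the second.
    have hu := eq_zero_of_vecMul_eq_zero (hA₁ z) h.1
    rw [hu, Matrix.zero_vecMul, zero_add] at h'
    exact (sumElim_eq_zero_iff _ _).2 ⟨hu, r₂ z v h.2 h'⟩
  · intro z x h h'
    obtain ⟨u, v, rfl⟩ := hx x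
    rw [eA, evalMatrix_fromBlocks, Matrix.fromBlocks_mulVec] at h
    rw [eC, evalMatrix_fromCols, Matrix.fromCols_mulVec_sumElim] at h'
    simp only [Sum.elim_comp_inl, Sum.elim_comp_inr, evalMatrix_zero, Matrix.zero_mulVec,
      add_zero, zero_add, sumElim_eq_zero_iff] at h
    have hu := eq_zero_of_mulVec_eq_zero (hA₁ z) h.1
    rw [hu, Matrix.mulVec_zero, zero_add] at h'
    exact (sumElim_eq_zero_iff _ _).2 ⟨hu, c₂ z v h.2 h'⟩
  · intro x h h'
    obtain ⟨u, v, rfl⟩ := hx x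
    rw [eA, coeffMatrix_fromBlocks, Matrix.vecMul_fromBlocks] at h
    rw [eB, coeffMatrix_fromRows, Matrix.sumElim_vecMul_fromRows] at h'
    simp only [Sum.elim_comp_inl, Sum.elim_comp_inr, coeffMatrix_zero, Matrix.vecMul_zero,
      add_zero, zero_add, sumElim_eq_zero_iff] at h
    -- At infinity the roles are exchanged: the second component dies first.
    have hu := eq_zero_of_vecMul_eq_zero hA₂ h.2
    rw [hu, Matrix.zero_vecMul, add_zero] at h'
    exact (sumElim_eq_zero_iff _ _).2 ⟨ri₁ u h.1 h', hu⟩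
  · intro x h h'
    obtain ⟨u, v, rfl⟩ := hx x
    rw [eA, coeffMatrix_fromBlocks, Matrix.fromBlocks_mulVec] at h
    rw [eC, coeffMatrix_fromCols, Matrix.fromCols_mulVec_sumElim] at h'
    simp only [Sum.elim_comp_inl, Sum.elim_comp_inr, coeffMatrix_zero, Matrix.zero_mulVec,
      add_zero, zero_add, sumElim_eq_zero_iff] at h
    have hu := eq_zero_of_mulVec_eq_zero hA₂ h.2
    rw [hu, Matrix.mulVec_zero, add_zero] at h'
    exact (sumElim_eq_zero_iff _ _).2 ⟨ci₁ u h.1 h', hu⟩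

end StronglyMinimal

/-! ### State space realizations -/

section Realization

variable {m n ν : ℕ}

/-- The Markov parameters `C F ^ a B` are the Laurent coefficients of `R` at infinity. -/
def IsRealization (R : Matrix (Fin m) (Fin n) (RatFunc ℂ)) (F : Matrix (Fin ν) (Fin ν) ℂ)
    (B : Matrix (Fin ν) (Fin n) ℂ) (C : Matrix (Fin m) (Fin ν) ℂ) : Prop :=
  ∀ (a : ℕ) i j, laurentCoeffAtInfinity (R i j) ((a : ℤ) + 1) = (C * F ^ a * B) i j

/-- The resolvent `(λ - F)⁻¹ B` has the Laurent coefficients `0, B, F B, F² B, …`. -/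
lemma laurentCoeffAtInfinity_resolvent {F : Matrix (Fin ν) (Fin ν) ℂ}
    {B : Matrix (Fin ν) (Fin n) ℂ} {Y : Matrix (Fin ν) (Fin n) (RatFunc ℂ)}
    (hY : toRat F.charmatrix * Y = toRat (constMatrix B)) :
    (∀ i ≤ (0 : ℤ), Y.map (laurentCoeffAtInfinity · i) = 0) ∧
      ∀ a : ℕ, Y.map (laurentCoeffAtInfinity · ((a : ℤ) + 1)) = F ^ a * B := by
  -- Coefficient comparison in `λ Y = F Y + B`, where `λ` shifts the index by one.
  have hrec (i : ℤ) : Y.map (laurentCoeffAtInfinity · (i + 1)) =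
      F * Y.map (laurentCoeffAtInfinity · i) + if i = 0 then B else 0 := by
    ext l j
    have h : algebraMap ℂ[X] (RatFunc ℂ) X * Y l j =
        ∑ l', algebraMap ℂ[X] (RatFunc ℂ) (C (F l l')) * Y l' j +
          algebraMap ℂ[X] (RatFunc ℂ) (C (B l j)) := by
      have := congrFun (congrFun hY l) j
      have e : toRat F.charmatrix = Matrix.diagonal (fun _ => algebraMap ℂ[X] (RatFunc ℂ) X) -
          toRat (constMatrix F) := by
        ext u v
        by_cases huv : u = v <;>
          simp [toRat, Matrix.charmatrix, constMatrix, huv]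
      rw [e, Matrix.sub_mul, Matrix.sub_apply, Matrix.diagonal_mul, sub_eq_iff_eq_add,
        Matrix.mul_apply] at this
      rw [this, add_comm]; rfl
    have h' := congrArg (laurentCoeffAtInfinity · i) h
    simp only [laurentCoeffAtInfinity_X_mul, laurentCoeffAtInfinity_add,
      laurentCoeffAtInfinity_sum, laurentCoeffAtInfinity_C_mul] at h'
    rw [Matrix.map_apply, h', Matrix.add_apply, Matrix.mul_apply]
    congr 1
    rcases lt_trichotomy i 0 with hi | hi | hi
    · obtain ⟨k, rfl⟩ := Int.exists_eq_neg_ofNat hi.le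
      rw [laurentCoeffAtInfinity_algebraMap_neg, coeff_C_of_ne_zero (by omega), if_neg hi.ne]; rfl
    · subst hi
      simpa using laurentCoeffAtInfinity_algebraMap_neg (C (B l j)) 0
    · rw [laurentCoeffAtInfinity_algebraMap_pos _ hi, if_neg hi.ne']; rfl
  have hlow : ∃ N : ℤ, ∀ i < N, Y.map (laurentCoeffAtInfinity · i) = 0 := by
    choose N hN using fun l j => exists_laurentCoeffAtInfinity_eq_zero (Y l j)
    obtain ⟨N₀, hN₀⟩ := (Set.finite_range (fun x : Fin ν × Fin n => N x.1 x.2)).bddBelow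
    refine ⟨N₀, fun i hi => ?_⟩
    ext l j
    exact hN l j i (hi.trans_le (hN₀ ⟨(l, j), rfl⟩))
  obtain ⟨N, hN⟩ := hlow
  -- Vanishing climbs from the lower bound `N` up to index `0`. The restriction `N + k ≤ 1` keeps
  -- the recursion at negative `i`, where `B` does not enter.
  have h0 (k : ℕ) : N + k ≤ 1 → ∀ i < N + k, Y.map (laurentCoeffAtInfinity · i) = 0 := by
    induction k with
    | zero => intro _ i hi; exact hN i (by simpa using hi)
    | succ k ih =>
      intro hk i hi
      have hk' : N + k ≤ 1 := by push_cast at hk; omega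
      rcases lt_or_ge i (N + k) with h | h
      · exact ih hk' i h
      · obtain ⟨i, rfl⟩ : ∃ i', i = i' + 1 := ⟨i - 1, by ring⟩
        push_cast at hk hi
        rw [hrec, ih hk' i (by omega), if_neg (by omega)]; simp
  have hle : ∀ i ≤ (0 : ℤ), Y.map (laurentCoeffAtInfinity · i) = 0 := by
    intro i hi
    rcases lt_or_ge i N with h | h
    · exact hN i h
    · exact h0 (1 - N).toNat (by omega) i (by omega)
  refine ⟨hle, fun a => ?_⟩
  induction a with
  | zero => simpa [hle 0 le_rfl] using hrec 0
  | succ a ih =>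
    have := hrec ((a : ℤ) + 1)
    rw [ih, if_neg (by omega), add_zero] at this
    push_cast
    rw [this, ← Matrix.mul_assoc, pow_succ']

variable {R : Matrix (Fin m) (Fin n) (RatFunc ℂ)} {F : Matrix (Fin ν) (Fin ν) ℂ}
    {B : Matrix (Fin ν) (Fin n) ℂ} {C : Matrix (Fin m) (Fin ν) ℂ}

lemma det_charmatrix_ne_zero (F : Matrix (Fin ν) (Fin ν) ℂ) : F.charmatrix.det ≠ 0 :=
  (Matrix.charpoly_monic F).ne_zero

lemma IsRealization.eq_transfer (h : IsRealization R F B C) (hR : IsStrictlyProper R) :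
    R = toRat (constMatrix C) * ((toRat F.charmatrix)⁻¹ * toRat (constMatrix B)) := by
  set Y := (toRat F.charmatrix)⁻¹ * toRat (constMatrix B) with hY
  have hYe : toRat F.charmatrix * Y = toRat (constMatrix B) := by
    rw [hY, Matrix.mul_nonsing_inv_cancel_left _ _
      (isUnit_det_toRat (det_charmatrix_ne_zero F))]
  obtain ⟨h0, h1⟩ := laurentCoeffAtInfinity_resolvent hYe
  ext i j
  apply ratFunc_ext_laurent
  intro l
  have e : laurentCoeffAtInfinity ((toRat (constMatrix C) * Y) i j) l =
      (C * Y.map (laurentCoeffAtInfinity · l)) i j := by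
    rw [Matrix.mul_apply, laurentCoeffAtInfinity_sum, Matrix.mul_apply]
    exact Finset.sum_congr rfl fun _ _ => laurentCoeffAtInfinity_C_mul _ _ _
  rw [e]
  rcases le_or_gt l 0 with hl | hl
  · rw [hR.laurentCoeffAtInfinity_eq_zero i j hl, h0 l hl]; simp
  · obtain ⟨a, rfl⟩ : ∃ a : ℕ, l = a + 1 := ⟨(l - 1).toNat, by omega⟩
    rw [h, h1, Matrix.mul_assoc]

/-- Reduces the regularity and inversion of the leading block to the characteristic matrix, whose
determinant is monic. -/
lemma constMatrix_mul_sub_X_smul (G F : Matrix (Fin ν) (Fin ν) ℂ) :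
    constMatrix (G * F) - (X : ℂ[X]) • constMatrix G = -(constMatrix G * F.charmatrix) := by
  have : F.charmatrix = (X : ℂ[X]) • 1 - constMatrix F := by
    ext u v
    by_cases huv : u = v <;> simp [Matrix.charmatrix, constMatrix, huv]
  rw [this, Matrix.mul_sub, Matrix.mul_smul, Matrix.mul_one, constMatrix_mul, neg_sub]

/-- An observable and reachable realization gives a strongly minimal linearization. -/
theorem IsRealization.isStronglyMinimalLinearization (h : IsRealization R F B C)
    (hR : IsStrictlyProper R) {G : Matrix (Fin ν) (Fin ν) ℂ} (hG : IsUnit G)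
    (hobs : ∀ x, (∀ a : ℕ, (C * F ^ a) *ᵥ x = 0) → x = 0)
    (hreach : ∀ x, (∀ a : ℕ, x ᵥ* (F ^ a * B) = 0) → x = 0) :
    IsStronglyMinimalLinearization
      (Matrix.fromBlocks (constMatrix (G * F) - (X : ℂ[X]) • constMatrix G)
        (constMatrix (G * B)) (constMatrix C) 0) R := by
  set L : Matrix (Fin ν ⊕ Fin m) (Fin ν ⊕ Fin n) ℂ[X] :=
    Matrix.fromBlocks (constMatrix (G * F) - (X : ℂ[X]) • constMatrix G)
        (constMatrix (G * B)) (constMatrix C) 0 with hL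
  have eA : blockA L = constMatrix (G * F) - (X : ℂ[X]) • constMatrix G := rfl
  have eB' : blockB L = -constMatrix (G * B) := rfl
  have eB : -blockB L = constMatrix (G * B) := neg_neg _
  have eC : blockC L = constMatrix C := rfl
  have eD : blockD L = 0 := rfl
  have hGd : G.det ≠ 0 := ((Matrix.isUnit_iff_isUnit_det _).1 hG).ne_zero
  have hGc : (constMatrix G).det ≠ 0 := by
    rw [det_constMatrix]; exact C_ne_zero.2 hGd
  refine ⟨⟨?_, ?_, ?_⟩, (isStronglyMinimal_iff _).2 ⟨?_, ?_, ?_, ?_⟩⟩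
  · rintro (i | i) (j | j)
    · simp only [hL, Matrix.fromBlocks_apply₁₁, Matrix.sub_apply, Matrix.smul_apply, constMatrix,
        Matrix.map_apply, smul_eq_mul]
      compute_degree
    · exact (natDegree_C _).trans_le zero_le_one
    · exact (natDegree_C _).trans_le zero_le_one
    · simp [hL]
  · rw [eA, constMatrix_mul_sub_X_smul, Matrix.det_neg, Matrix.det_mul]
    exact mul_ne_zero (by simp) (mul_ne_zero hGc (det_charmatrix_ne_zero F))
  · rw [eA, eB', eC, eD, toRat_zero, zero_add, constMatrix_mul_sub_X_smul, constMatrix_mul,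
      toRat_neg, toRat_neg, toRat_mul, toRat_mul, h.eq_transfer hR]
    have hi : (-(toRat (constMatrix G) * toRat F.charmatrix))⁻¹ =
        -((toRat F.charmatrix)⁻¹ * (toRat (constMatrix G))⁻¹) := by
      apply Matrix.inv_eq_left_inv
      rw [Matrix.neg_mul, Matrix.mul_neg, neg_neg, Matrix.mul_assoc,
        Matrix.nonsing_inv_mul_cancel_left _ _ (isUnit_det_toRat hGc),
        Matrix.nonsing_inv_mul _ (isUnit_det_toRat (det_charmatrix_ne_zero F))]
    rw [hi, Matrix.mul_neg, Matrix.mul_neg, Matrix.neg_mul, neg_neg, Matrix.mul_assoc, Matrix.mul_assoc,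
      Matrix.nonsing_inv_mul_cancel_left _ _ (isUnit_det_toRat hGc)]
  · intro z x h1 h2
    rw [eA] at h1
    rw [eB, evalMatrix_constMatrix] at h2
    simp only [evalMatrix_sub, evalMatrix_constMatrix, evalMatrix_X_smul] at h1
    rw [Matrix.vecMul_sub, sub_eq_zero, Matrix.vecMul_smul, ← Matrix.vecMul_vecMul] at h1
    -- `x G` is a left eigenvector of `F` for `z`, so `x G B = 0` makes it annihilate every `F ^ a
    -- B`, against reachability.
    have hp (a : ℕ) : (x ᵥ* G) ᵥ* F ^ a = z ^ a • (x ᵥ* G) := by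
      induction a with
      | zero => simp
      | succ a ih =>
        rw [pow_succ, ← Matrix.vecMul_vecMul, ih, Matrix.smul_vecMul, h1, smul_smul, pow_succ]
    apply eq_zero_of_vecMul_eq_zero hG
    apply hreach
    intro a
    rw [← Matrix.vecMul_vecMul, hp, Matrix.smul_vecMul, Matrix.vecMul_vecMul, h2, smul_zero]
  · intro z x h1 h2
    rw [eA] at h1
    rw [eC, evalMatrix_constMatrix] at h2
    simp only [evalMatrix_sub, evalMatrix_constMatrix, evalMatrix_X_smul] at h1
    have h3 : F *ᵥ x = z • x := by
      rw [← sub_eq_zero]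
      apply eq_zero_of_mulVec_eq_zero hG
      rw [Matrix.mulVec_sub, Matrix.mulVec_smul, Matrix.mulVec_mulVec, ← h1, Matrix.sub_mulVec,
        Matrix.smul_mulVec]
    have hp (a : ℕ) : F ^ a *ᵥ x = z ^ a • x := by
      induction a with
      | zero => simp
      | succ a ih =>
        rw [pow_succ', ← Matrix.mulVec_mulVec, ih, Matrix.mulVec_smul, h3, smul_smul, pow_succ]
    apply hobs
    intro a
    rw [← Matrix.mulVec_mulVec, hp, Matrix.mulVec_smul, h2, smul_zero]
  · intro x h1 _
    simp only [eA, coeffMatrix_sub, coeffMatrix_constMatrix_one,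
      coeffMatrix_X_smul_constMatrix_one, zero_sub, Matrix.vecMul_neg, neg_eq_zero] at h1
    exact eq_zero_of_vecMul_eq_zero hG h1
  · intro x h1 _
    simp only [eA, coeffMatrix_sub, coeffMatrix_constMatrix_one,
      coeffMatrix_X_smul_constMatrix_one, zero_sub, Matrix.neg_mulVec, neg_eq_zero] at h1
    exact eq_zero_of_mulVec_eq_zero hG h1

end Realization

/-! ### Compressions by unitary matrices -/

section Compression

variable {p q : Type*} [Fintype p] [DecidableEq p] [Fintype q] [DecidableEq q]
  {T : Matrix p q ℂ} {a b r : ℕ}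

lemma fromCols_gram {s t : ℕ} {U₁ : Matrix p (Fin s) ℂ} {U₂ : Matrix p (Fin t) ℂ}
    (h : IsUnitary (Matrix.fromCols U₁ U₂)) : U₁ᴴ * U₁ = 1 ∧ U₂ᴴ * U₂ = 1 := by
  have := h.1
  rw [Matrix.conjTranspose_fromCols_eq_fromRows_conjTranspose, Matrix.fromRows_mul_fromCols,
    ← Matrix.fromBlocks_one, Matrix.fromBlocks_inj] at this
  exact ⟨this.1, this.2.2.2⟩

lemma eq_of_unitary_compression {p' q' : Type*} [Fintype p'] [DecidableEq p'] [Fintype q']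
    [DecidableEq q'] {U : Matrix p p' ℂ} {V : Matrix q q' ℂ} (hU : IsUnitary U) (hV : IsUnitary V)
    {M : Matrix p' q' ℂ} (h : Uᴴ * T * V = M) : T = U * M * Vᴴ := by
  rw [← h]
  calc T = (U * Uᴴ) * T * (V * Vᴴ) := by rw [hU.2, hV.2, Matrix.one_mul, Matrix.mul_one]
    _ = _ := by simp only [Matrix.mul_assoc]

lemma CompressesLowerRight.eq_mul {U₁ : Matrix p (Fin a) ℂ} {U₂ : Matrix p (Fin r) ℂ}
    {V₁ : Matrix q (Fin b) ℂ} {V₂ : Matrix q (Fin r) ℂ} (h : CompressesLowerRight T U₁ U₂ V₁ V₂) :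
    T = U₂ * (U₂ᴴ * T * V₂) * V₂ᴴ := by
  have := eq_of_unitary_compression h.unitary_left h.unitary_right h.compress
  conv_lhs => rw [this]
  rw [Matrix.conjTranspose_fromCols_eq_fromRows_conjTranspose, Matrix.fromCols_mul_fromBlocks,
    Matrix.fromCols_mul_fromRows]
  simp

lemma CompressesUpperLeft.eq_mul {U₁ : Matrix p (Fin r) ℂ} {U₂ : Matrix p (Fin a) ℂ}
    {V₁ : Matrix q (Fin r) ℂ} {V₂ : Matrix q (Fin b) ℂ} (h : CompressesUpperLeft T U₁ U₂ V₁ V₂) :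
    T = U₁ * (U₁ᴴ * T * V₁) * V₁ᴴ := by
  have := eq_of_unitary_compression h.unitary_left h.unitary_right h.compress
  conv_lhs => rw [this]
  rw [Matrix.conjTranspose_fromCols_eq_fromRows_conjTranspose, Matrix.fromCols_mul_fromBlocks,
    Matrix.fromCols_mul_fromRows]
  simp

end Compression

/-! ### Hankel matrices of a realization -/

section Hankel

variable {m n ν : ℕ}

/-- The observability matrix with block rows `C F ^ a` for `a < k`. -/
noncomputable def obsMatrix (C : Matrix (Fin m) (Fin ν) ℂ) (F : Matrix (Fin ν) (Fin ν) ℂ) (k : ℕ) :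
    Matrix (Fin k × Fin m) (Fin ν) ℂ :=
  Matrix.of fun x l => (C * F ^ x.1.val) x.2 l

/-- The reachability matrix with block columns `F ^ b B` for `b < k`. -/
noncomputable def reachMatrix (F : Matrix (Fin ν) (Fin ν) ℂ) (B : Matrix (Fin ν) (Fin n) ℂ) (k : ℕ) :
    Matrix (Fin ν) (Fin k × Fin n) ℂ :=
  Matrix.of fun l y => (F ^ y.1.val * B) l y.2

variable {R : Matrix (Fin m) (Fin n) (RatFunc ℂ)} {F : Matrix (Fin ν) (Fin ν) ℂ}
    {B : Matrix (Fin ν) (Fin n) ℂ} {C : Matrix (Fin m) (Fin ν) ℂ}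

lemma IsRealization.hankelH_eq (h : IsRealization R F B C) (k : ℕ) :
    hankelH R k = obsMatrix C F k * reachMatrix F B k := by
  ext ⟨a, i⟩ ⟨b, j⟩
  have := h (a.val + b.val) i j
  push_cast at this
  rw [hankelH, Matrix.of_apply, this, pow_add, ← Matrix.mul_assoc, Matrix.mul_assoc (C * _)]
  rfl

lemma IsRealization.hankelHShift_eq (h : IsRealization R F B C) (k : ℕ) :
    hankelHShift R k = obsMatrix C F k * F * reachMatrix F B k := by
  ext ⟨a, i⟩ ⟨b, j⟩
  have := h (a.val + 1 + b.val) i j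
  have e : ((a.val + 1 + b.val : ℕ) : ℤ) + 1 = (a.val : ℤ) + b.val + 2 := by push_cast; ring
  rw [e] at this
  rw [hankelHShift, Matrix.of_apply, this, pow_add, pow_succ, ← Matrix.mul_assoc,
    ← Matrix.mul_assoc, Matrix.mul_assoc (C * _ * F)]
  rfl

/-- The common kernels of the first `k` maps form a decreasing chain of subspaces of a
finite-dimensional space, which stabilizes. Applied to observability and reachability, it yields the
bound on `k`. -/
lemma exists_forall_ge_of_forall {V W : Type*} [AddCommGroup V] [Module ℂ V] [FiniteDimensional ℂ V]
    [AddCommGroup W] [Module ℂ W] (g : ℕ → V →ₗ[ℂ] W) (h : ∀ x, (∀ a, g a x = 0) → x = 0) :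
    ∃ K, ∀ k ≥ K, ∀ x, (∀ a < k, g a x = 0) → x = 0 := by
  let N (k : ℕ) : Submodule ℂ V := ⨅ a ∈ Finset.range k, LinearMap.ker (g a)
  have hN (k : ℕ) (x : V) : x ∈ N k ↔ ∀ a < k, g a x = 0 := by simp [N]
  have hanti : Antitone N := fun k l hkl x hx => (hN k x).2 fun a ha =>
    (hN l x).1 hx a (ha.trans_le hkl)
  obtain ⟨K, hK⟩ := IsArtinian.monotone_stabilizes (⟨N, hanti⟩ : ℕ →o (Submodule ℂ V)ᵒᵈ)
  refine ⟨K, fun k hk x hx => h x fun a => ?_⟩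
  have h1 : N K = N k := hK k hk
  have h2 : N K = N (k + a + 1) := hK (k + a + 1) (by omega)
  have : x ∈ N (k + a + 1) := by rw [← h2, h1]; exact (hN k x).2 hx
  exact (hN _ x).1 this a (by omega)

lemma rank_mul_eq_of_injective {p q : Type*} [Fintype p] [Fintype q] {O : Matrix p (Fin ν) ℂ}
    {Q : Matrix (Fin ν) q ℂ} (hO : ∀ x, O *ᵥ x = 0 → x = 0) (hQ : ∀ x, x ᵥ* Q = 0 → x = 0) :
    (O * Q).rank = ν := by
  have hQr : Q.rank = ν := by simpa using (rank_eq_card_rows_iff Q).2 hQ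
  rw [Matrix.rank] at hQr
  rw [Matrix.rank, Matrix.mulVecLin_mul, LinearMap.range_comp]
  exact (LinearEquiv.finrank_eq (Submodule.equivMapOfInjective O.mulVecLin
      ((injective_iff_map_eq_zero O.mulVecLin).2 hO) (LinearMap.range Q.mulVecLin))).symm.trans hQr

/-- For an observable and reachable realization, large Hankel matrices have rank the dimension. -/
lemma IsRealization.exists_rank_hankelH_eq (h : IsRealization R F B C)
    (hobs : ∀ x, (∀ a : ℕ, (C * F ^ a) *ᵥ x = 0) → x = 0)
    (hreach : ∀ x, (∀ a : ℕ, x ᵥ* (F ^ a * B) = 0) → x = 0) :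
    ∃ K, ∀ k, K ≤ k → (hankelH R k).rank = ν := by
  obtain ⟨K₁, h₁⟩ := exists_forall_ge_of_forall (fun a => (C * F ^ a).mulVecLin) hobs
  obtain ⟨K₂, h₂⟩ := exists_forall_ge_of_forall (fun a => (F ^ a * B).vecMulLinear) hreach
  refine ⟨max K₁ K₂, fun k hk => ?_⟩
  rw [h.hankelH_eq]
  apply rank_mul_eq_of_injective
  · intro x hx
    refine h₁ k ((le_max_left _ _).trans hk) x fun a ha => ?_
    ext i
    exact congrFun hx (⟨a, ha⟩, i)
  · intro x hx
    refine h₂ k ((le_max_right _ _).trans hk) x fun a ha => ?_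
    ext i
    exact congrFun hx (⟨a, ha⟩, i)

theorem IsRealization.strictlyProperLinearization (h : IsRealization R F B C)
    (hR : IsStrictlyProper R) {k : ℕ} (hk : 0 < k) {a b : ℕ}
    {U₁ : Matrix (Fin k × Fin m) (Fin ν) ℂ} {U₂ : Matrix (Fin k × Fin m) (Fin a) ℂ}
    {V₁ : Matrix (Fin k × Fin n) (Fin ν) ℂ} {V₂ : Matrix (Fin k × Fin n) (Fin b) ℂ}
    (hc : CompressesUpperLeft (hankelH R k) U₁ U₂ V₁ V₂) :
    IsStronglyMinimalLinearization (strictlyProperLinearization R hk U₁ V₁) R := by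
  have hU := (fromCols_gram hc.unitary_left).1
  have hV := (fromCols_gram hc.unitary_right).1
  have hH := hc.eq_mul
  have hG := hc.invertible
  generalize hGdef : U₁ᴴ * hankelH R k * V₁ = G at hH hG
  have hGd := (Matrix.isUnit_iff_isUnit_det _).1 hG
  set O := obsMatrix C F k with hO
  set Q := reachMatrix F B k with hQ
  have hOQ : hankelH R k = O * Q := h.hankelH_eq k
  -- `S' = Q V₁` is the change of state basis and `S` its inverse: `Ĥ = U₁ᴴ O Q V₁` is an invertible
  -- square matrix of the size of the state space, and a one-sided inverse of a square matrix is
  -- two-sided.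
  set S := G⁻¹ * U₁ᴴ * O with hS
  set S' := Q * V₁ with hS'
  have hSS' : S * S' = 1 := by
    calc S * S' = G⁻¹ * (U₁ᴴ * (O * Q) * V₁) := by simp only [hS, hS', Matrix.mul_assoc]
      _ = 1 := by rw [← hOQ, hGdef, Matrix.nonsing_inv_mul _ hGd]
  have hS'S : S' * S = 1 := mul_eq_one_comm.1 hSS'
  have hGS : G * S = U₁ᴴ * O := by
    rw [hS, Matrix.mul_assoc _ U₁ᴴ, Matrix.mul_nonsing_inv_cancel_left _ _ hGd]
  have hV₁ : V₁ᴴ = S * Q := by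
    calc V₁ᴴ = G⁻¹ * (U₁ᴴ * (U₁ * G * V₁ᴴ)) := by
          simp only [← Matrix.mul_assoc, hU, Matrix.one_mul, Matrix.nonsing_inv_mul _ hGd]
      _ = S * Q := by rw [← hH, hOQ, hS]; simp only [Matrix.mul_assoc]
  have hU₁ : U₁ * G = O * S' := by
    calc U₁ * G = U₁ * G * V₁ᴴ * V₁ := by rw [Matrix.mul_assoc _ V₁ᴴ, hV, Matrix.mul_one]
      _ = O * S' := by rw [← hH, hOQ, hS', Matrix.mul_assoc]
  have hpow (j : ℕ) : (S * F * S') ^ j = S * F ^ j * S' := by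
    induction j with
    | zero => simp [hSS']
    | succ j ih =>
      rw [pow_succ, ih, pow_succ]
      calc S * F ^ j * S' * (S * F * S') = S * F ^ j * (S' * S) * F * S' := by
            simp only [Matrix.mul_assoc]
        _ = _ := by rw [hS'S]; simp only [Matrix.mul_one, Matrix.mul_assoc]
  have hCpow (j : ℕ) : C * S' * (S * F * S') ^ j = C * F ^ j * S' := by
    rw [hpow]
    calc C * S' * (S * F ^ j * S') = C * (S' * S) * F ^ j * S' := by simp only [Matrix.mul_assoc]
      _ = _ := by rw [hS'S, Matrix.mul_one]
  have hpowB (j : ℕ) : (S * F * S') ^ j * (S * B) = S * (F ^ j * B) := by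
    rw [hpow]
    calc S * F ^ j * S' * (S * B) = S * F ^ j * (S' * S) * B := by simp only [Matrix.mul_assoc]
      _ = _ := by rw [hS'S, Matrix.mul_one, Matrix.mul_assoc]
  have hreal : IsRealization R (S * F * S') (S * B) (C * S') := by
    intro j i l
    rw [h, hCpow]
    refine congrFun (congrFun ?_ i) l
    calc C * F ^ j * B = C * F ^ j * (S' * S) * B := by rw [hS'S, Matrix.mul_one]
      _ = _ := by simp only [Matrix.mul_assoc]
  have key := hreal.isStronglyMinimalLinearization hR hG ?_ ?_
  · convert key using 1
    have e1 : U₁ᴴ * hankelHShift R k * V₁ = G * (S * F * S') := by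
      rw [h.hankelHShift_eq, Matrix.mul_assoc S, ← Matrix.mul_assoc G, hGS]
      simp only [hS', ← hO, ← hQ, Matrix.mul_assoc]
    -- The first block of `Q` is `F ^ 0 B`; likewise the first block of `O` is `C F ^ 0`.
    have e2 : (firstBlock hk V₁)ᴴ = S * B := by
      have : (firstBlock hk V₁)ᴴ = V₁ᴴ.submatrix id (fun j => (⟨0, hk⟩, j)) := rfl
      rw [this, hV₁]
      ext i j
      rw [Matrix.submatrix_apply, Matrix.mul_apply, Matrix.mul_apply]
      simp [hQ, reachMatrix]
    have e3 : firstBlock hk U₁ * G = C * S' := by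
      have : firstBlock hk U₁ * G = (U₁ * G).submatrix (fun j => (⟨0, hk⟩, j)) id := rfl
      rw [this, hU₁]
      ext i j
      rw [Matrix.submatrix_apply, Matrix.mul_apply, Matrix.mul_apply]
      simp [hO, obsMatrix]
    rw [RationalLinearization.strictlyProperLinearization, e1, e2, hGdef, e3]
  · intro x hx
    apply eq_zero_of_mulVec_eq_zero hG
    -- Observability is read off from `O S' = U₁ Ĥ`, which is injective; reachability below comes
    -- from `S Q = V₁ᴴ`. Neither has to be known for the given realization.
    have : (U₁ * G) *ᵥ x = 0 := by
      rw [hU₁, ← Matrix.mulVec_mulVec]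
      ext ⟨c, i⟩
      have := hx c.val
      rw [hCpow, ← Matrix.mulVec_mulVec] at this
      exact congrFun this i
    calc G *ᵥ x = U₁ᴴ *ᵥ ((U₁ * G) *ᵥ x) := by
          rw [Matrix.mulVec_mulVec, ← Matrix.mul_assoc, hU, Matrix.one_mul]
      _ = 0 := by rw [this, Matrix.mulVec_zero]
  · intro x hx
    have : x ᵥ* V₁ᴴ = 0 := by
      rw [hV₁, ← Matrix.vecMul_vecMul]
      ext ⟨c, i⟩
      have := hx c.val
      rw [hpowB, ← Matrix.vecMul_vecMul] at this
      exact congrFun this i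
    calc x = (x ᵥ* V₁ᴴ) ᵥ* V₁ := by rw [Matrix.vecMul_vecMul, hV, Matrix.vecMul_one]
      _ = 0 := by rw [this, Matrix.zero_vecMul]

end Hankel

/-! ### The linearization of the polynomial part -/

section PolynomialPart

variable {m n : ℕ}

/-- The coefficient of `λ` in the leading block of the Lancaster pencil. -/
noncomputable def hankelS (P : Matrix (Fin m) (Fin n) ℂ[X]) (d : ℕ) :
    Matrix (Fin (d - 1) × Fin m) (Fin (d - 1) × Fin n) ℂ :=
  Matrix.of fun x y => coeffMatrix P (2 * d - 1 - x.1.val - y.1.val) x.2 y.2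

/-- The block column with blocks `P_{d-a}`. -/
noncomputable def coeffColumn (P : Matrix (Fin m) (Fin n) ℂ[X]) (d : ℕ) :
    Matrix (Fin (d - 1) × Fin m) (Fin n) ℂ :=
  Matrix.of fun x j => coeffMatrix P (d - x.1.val) x.2 j

/-- The block row with blocks `P_{d-b}`. -/
noncomputable def coeffRow (P : Matrix (Fin m) (Fin n) ℂ[X]) (d : ℕ) :
    Matrix (Fin m) (Fin (d - 1) × Fin n) ℂ :=
  Matrix.of fun i y => coeffMatrix P (d - y.1.val) i y.2

lemma lancasterPencil_eq (P : Matrix (Fin m) (Fin n) ℂ[X]) (d : ℕ) :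
    lancasterPencil P d = Matrix.fromBlocks
      ((X : ℂ[X]) • constMatrix (hankelS P d) - constMatrix (hankelT P d))
      ((X : ℂ[X]) • constMatrix (coeffColumn P d)) ((X : ℂ[X]) • constMatrix (coeffRow P d))
      ((lancasterPencil P d).toBlocks₂₂) := by
  ext (i | i) (j | j) <;> rfl

variable {P : Matrix (Fin m) (Fin n) ℂ[X]} {d : ℕ}

/-- The index depends only on the sum of the block positions, so every statement on right kernels
follows from the one on left kernels applied to `Pᵀ`. -/
lemma hankelT_transpose : hankelT Pᵀ d = (hankelT P d)ᵀ := by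
  ext x y
  simp only [hankelT, coeffMatrix, Matrix.of_apply, Matrix.transpose_apply, Matrix.map_apply,
    Nat.sub_right_comm]

lemma hankelS_transpose : hankelS Pᵀ d = (hankelS P d)ᵀ := by
  ext x y
  simp only [hankelS, coeffMatrix, Matrix.of_apply, Matrix.transpose_apply, Matrix.map_apply,
    Nat.sub_right_comm]

lemma coeffColumn_transpose : coeffColumn Pᵀ d = (coeffRow P d)ᵀ := rfl

/-- For `a ≤ d - 2` the index `2d - 1 - a` exceeds `d`. Together with `hankelS_succ` and
`coeffColumn_eq` this is the shift relation `[S K] = [0 T]` behind all kernel statements. -/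
lemma hankelS_zero (hP : ∀ i j, (P i j).natDegree ≤ d) (x : Fin (d - 1) × Fin m)
    (h : 0 < d - 1) (j : Fin n) : hankelS P d x (⟨0, h⟩, j) = 0 := by
  have := x.1.2
  exact coeff_eq_zero_of_natDegree_lt ((hP x.2 j).trans_lt (by simp only; omega))

lemma hankelS_succ (x : Fin (d - 1) × Fin m) {b : ℕ} (h : b + 1 < d - 1) (j : Fin n) :
    hankelS P d x (⟨b + 1, h⟩, j) = hankelT P d x (⟨b, by omega⟩, j) := by
  have := x.1.2
  simp only [hankelS, hankelT, Matrix.of_apply]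
  congr 1
  omega

lemma coeffColumn_eq (x : Fin (d - 1) × Fin m) {b : ℕ} (h : b + 1 = d - 1) (j : Fin n) :
    coeffColumn P d x j = hankelT P d x (⟨b, by omega⟩, j) := by
  have := x.1.2
  simp only [coeffColumn, hankelT, Matrix.of_apply]
  congr 1
  omega

lemma vecMul_hankelS_zero (hP : ∀ i j, (P i j).natDegree ≤ d) (x : Fin (d - 1) × Fin m → ℂ)
    (h : 0 < d - 1) (j : Fin n) : (x ᵥ* hankelS P d) (⟨0, h⟩, j) = 0 := by
  simp [Matrix.vecMul, dotProduct, hankelS_zero hP]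

lemma vecMul_hankelS_succ (x : Fin (d - 1) × Fin m → ℂ) {b : ℕ} (h : b + 1 < d - 1) (j : Fin n) :
    (x ᵥ* hankelS P d) (⟨b + 1, h⟩, j) = (x ᵥ* hankelT P d) (⟨b, by omega⟩, j) := by
  simp [Matrix.vecMul, dotProduct, hankelS_succ]

lemma vecMul_coeffColumn (x : Fin (d - 1) × Fin m → ℂ) {b : ℕ} (h : b + 1 = d - 1) (j : Fin n) :
    (x ᵥ* coeffColumn P d) j = (x ᵥ* hankelT P d) (⟨b, by omega⟩, j) := by
  simp [Matrix.vecMul, dotProduct, coeffColumn_eq _ h]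

lemma vecMul_hankelS_eq_zero (hP : ∀ i j, (P i j).natDegree ≤ d) {x : Fin (d - 1) × Fin m → ℂ}
    (hx : x ᵥ* hankelT P d = 0) : x ᵥ* hankelS P d = 0 := by
  ext ⟨⟨b, hb⟩, j⟩
  cases b with
  | zero => exact vecMul_hankelS_zero hP x hb j
  | succ b => rw [vecMul_hankelS_succ, hx]; rfl

/-- Here `xT = z xS`. The first block column of `S` is zero and each later one is the preceding
column of `T`, so the blocks of `xT` vanish in turn. -/
lemma vecMul_hankelT_eq_zero_of_pencil (hP : ∀ i j, (P i j).natDegree ≤ d) (z : ℂ)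
    {x : Fin (d - 1) × Fin m → ℂ} (hx : x ᵥ* (z • hankelS P d - hankelT P d) = 0) :
    x ᵥ* hankelT P d = 0 := by
  rw [Matrix.vecMul_sub, Matrix.vecMul_smul, sub_eq_zero] at hx
  ext ⟨⟨b, hb⟩, j⟩
  induction b with
  | zero =>
    rw [← hx, Pi.smul_apply, vecMul_hankelS_zero hP x hb j]; simp
  | succ b ih =>
    rw [← hx, Pi.smul_apply, vecMul_hankelS_succ, ih]; simp

lemma vecMul_hankelT_eq_zero {x : Fin (d - 1) × Fin m → ℂ}
    (hS : x ᵥ* hankelS P d = 0) (hB : x ᵥ* coeffColumn P d = 0) : x ᵥ* hankelT P d = 0 := by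
  ext ⟨⟨b, hb⟩, j⟩
  rcases lt_or_ge (b + 1) (d - 1) with h | h
  · rw [← vecMul_hankelS_succ x h, hS]; rfl
  · rw [← vecMul_coeffColumn x (le_antisymm hb h), hB]; rfl

lemma hankelS_mulVec_eq_zero (hP : ∀ i j, (P i j).natDegree ≤ d) {x : Fin (d - 1) × Fin n → ℂ}
    (hx : hankelT P d *ᵥ x = 0) : hankelS P d *ᵥ x = 0 := by
  rw [← Matrix.vecMul_transpose, ← hankelS_transpose]
  apply vecMul_hankelS_eq_zero (P := Pᵀ) (fun i j => hP j i)
  rw [hankelT_transpose, Matrix.vecMul_transpose, hx]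

lemma vecMul_coeffColumn_eq_zero {x : Fin (d - 1) × Fin m → ℂ}
    (hx : x ᵥ* hankelT P d = 0) : x ᵥ* coeffColumn P d = 0 := by
  ext j
  rcases Nat.eq_zero_or_pos (d - 1) with h | h
  · have : IsEmpty (Fin (d - 1)) := by rw [h]; infer_instance
    simp [Matrix.vecMul, dotProduct]
  · rw [vecMul_coeffColumn x (b := d - 1 - 1) (by omega), hx]; rfl

lemma coeffRow_mulVec_eq_zero {x : Fin (d - 1) × Fin n → ℂ}
    (hx : hankelT P d *ᵥ x = 0) : coeffRow P d *ᵥ x = 0 := by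
  rw [← Matrix.vecMul_transpose, ← coeffColumn_transpose]
  apply vecMul_coeffColumn_eq_zero
  rw [hankelT_transpose, Matrix.vecMul_transpose, hx]

lemma hankelT_mulVec_eq_zero {x : Fin (d - 1) × Fin n → ℂ}
    (hS : hankelS P d *ᵥ x = 0) (hC : coeffRow P d *ᵥ x = 0) : hankelT P d *ᵥ x = 0 := by
  rw [← Matrix.vecMul_transpose] at *
  rw [← hankelS_transpose] at hS
  rw [← hankelT_transpose]
  exact vecMul_hankelT_eq_zero hS hC

/-- The columns of `E - 1` lie in the kernel of `T`, hence in that of `S`. With `E = V₂V₂ᴴ` it shows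
that compression loses no information about `S` and `C_s`. -/
lemma mul_eq_self_of_ker {p q s : Type*} [Fintype p] [Fintype q] [DecidableEq q]
    {T : Matrix p q ℂ} {S : Matrix s q ℂ} {E : Matrix q q ℂ}
    (hTS : ∀ x, T *ᵥ x = 0 → S *ᵥ x = 0) (hT : T * E = T) : S * E = S := by
  rw [← sub_eq_zero]
  apply Matrix.ext_of_mulVec_single
  intro i
  rw [Matrix.sub_mulVec, ← Matrix.mulVec_mulVec, ← Matrix.mulVec_sub, Matrix.zero_mulVec]
  apply hTS
  rw [Matrix.mulVec_sub, Matrix.mulVec_mulVec, hT, sub_self]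

lemma mul_eq_self_of_coker {p q s : Type*} [Fintype p] [Fintype q] [DecidableEq p]
    {T : Matrix p q ℂ} {S : Matrix p s ℂ} {E : Matrix p p ℂ}
    (hTS : ∀ x, x ᵥ* T = 0 → x ᵥ* S = 0) (hT : E * T = T) : E * S = S := by
  rw [← Matrix.transpose_inj, Matrix.transpose_mul]
  refine mul_eq_self_of_ker (T := Tᵀ) (fun x hx => ?_) ?_
  · rw [Matrix.mulVec_transpose] at hx ⊢; exact hTS x hx
  · rw [← Matrix.transpose_mul, hT]

/-- The solution of `A_s W = B_s`, with blocks `λ ^ (d - 1 - b)`. -/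
noncomputable def powerColumn (n d : ℕ) : Matrix (Fin (d - 1) × Fin n) (Fin n) ℂ[X] :=
  Matrix.of fun y j => if y.2 = j then X ^ (d - 1 - y.1.val) else 0

lemma mul_powerColumn_apply {p : Type*} (M : Matrix p (Fin (d - 1) × Fin n) ℂ[X]) (x : p)
    (l : Fin n) :
    (M * powerColumn n d) x l = ∑ b : Fin (d - 1), M x (b, l) * X ^ (d - 1 - b.val) := by
  rw [Matrix.mul_apply, Fintype.sum_prod_type]
  simp [powerColumn]

lemma leading_mul_powerColumn (hP : ∀ i j, (P i j).natDegree ≤ d) :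
    ((X : ℂ[X]) • constMatrix (hankelS P d) - constMatrix (hankelT P d)) * powerColumn n d =
      -((X : ℂ[X]) • constMatrix (coeffColumn P d)) := by
  ext1 ⟨⟨a, ha⟩, i⟩ l
  obtain ⟨N, rfl⟩ : ∃ N, d = N + 1 := ⟨d - 1, by omega⟩
  rw [mul_powerColumn_apply]
  -- The product telescopes: block `b` contributes `f b - f (b + 1)`. The first term `f 0` vanishes
  -- because its index exceeds `d`, and the last is the wanted `λ P_{d-a}`.
  let f (b : ℕ) : ℂ[X] := C ((P i l).coeff (2 * (N + 1) - 1 - a - b)) * X ^ (N + 1 - b)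
  have hf (b : Fin N) : (((X : ℂ[X]) • constMatrix (hankelS P (N + 1)) -
      constMatrix (hankelT P (N + 1))) (⟨a, ha⟩, i) (b, l)) * X ^ (N + 1 - 1 - b.val) =
      f b - f (b + 1) := by
    have hb := b.2
    simp only [Nat.add_sub_cancel] at ha
    simp only [Matrix.sub_apply, Matrix.smul_apply, constMatrix, Matrix.map_apply, hankelS,
      hankelT, Matrix.of_apply, coeffMatrix, smul_eq_mul, f, Nat.add_sub_cancel]
    have e1 : N + 1 - b.val = (N - b.val) + 1 := by omega
    have e2 : N + 1 - (b.val + 1) = N - b.val := by omega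
    have e3 : 2 * (N + 1) - 1 - a - (b.val + 1) = 2 * (N + 1) - 2 - a - b.val := by omega
    rw [e1, e2, e3]
    ring
  have hsum : ∑ b : Fin N, (f b - f (b + 1)) = f 0 - f N := by
    rw [Fin.sum_univ_eq_sum_range (fun b => f b - f (b + 1)) N, Finset.sum_range_sub']
  simp only [Nat.add_sub_cancel] at ha
  have e0 : f 0 = 0 := by
    simp only [f]
    rw [coeff_eq_zero_of_natDegree_lt ((hP i l).trans_lt (by omega))]; simp
  have eN : f N = X * C ((P i l).coeff (N + 1 - a)) := by
    simp only [f]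
    rw [show 2 * (N + 1) - 1 - a - N = N + 1 - a by omega, Nat.add_sub_cancel_left, pow_one,
      mul_comm]
  calc _ = ∑ b : Fin N, (f b - f (b + 1)) := Finset.sum_congr rfl fun b _ => hf b
    _ = _ := by rw [hsum, e0, eN, zero_sub]; rfl

lemma coeffRow_mul_powerColumn_add (hP : ∀ i j, (P i j).natDegree ≤ d) :
    ((X : ℂ[X]) • constMatrix (coeffRow P d)) * powerColumn n d + (lancasterPencil P d).toBlocks₂₂
      = P := by
  ext1 i l
  rw [Matrix.add_apply, mul_powerColumn_apply]
  have hD : (lancasterPencil P d).toBlocks₂₂ i l =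
    X * C ((P i l).coeff 1) + C ((P i l).coeff 0) := rfl
  rw [hD]
  cases d with
  | zero =>
    -- For `d = 0` the powers contribute nothing and `D_s` still contains `λ P₁`, which vanishes by
    -- the degree bound.
    have h := hP i l
    rw [coeff_eq_zero_of_natDegree_lt (h.trans_lt one_pos)]
    simpa using (eq_C_of_natDegree_le_zero h).symm
  | succ N =>
    have h := (P i l).as_sum_range_C_mul_X_pow' (n := N + 2) (Nat.lt_succ_of_le (hP i l))
    -- Splits off `P₀` and `P₁`, which make up `D_s`; reflection matches the descending powers of
    -- `powerColumn`.
    conv_rhs => rw [h, Finset.sum_range_succ', Finset.sum_range_succ', ← Finset.sum_range_reflect]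
    rw [Finset.sum_range, add_assoc]
    congr 1
    · refine Finset.sum_congr rfl fun b _ => ?_
      have hb : b.val < N := b.2
      simp only [Matrix.smul_apply, constMatrix, Matrix.map_apply, coeffRow, Matrix.of_apply,
        coeffMatrix, smul_eq_mul, Nat.add_sub_cancel]
      rw [show N + 1 - b.val = N - 1 - b.val + 1 + 1 by omega,
        show N - b.val = N - 1 - b.val + 1 by omega]
      ring
    · simp only [zero_add, pow_one, pow_zero, mul_one]
      rw [mul_comm]

variable {a b r : ℕ} {U₁ : Matrix (Fin (d - 1) × Fin m) (Fin a) ℂ}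
  {U₂ : Matrix (Fin (d - 1) × Fin m) (Fin r) ℂ} {V₁ : Matrix (Fin (d - 1) × Fin n) (Fin b) ℂ}
  {V₂ : Matrix (Fin (d - 1) × Fin n) (Fin r) ℂ}

lemma polynomialLinearization_eq (P : Matrix (Fin m) (Fin n) ℂ[X])
    (U₂ : Matrix (Fin (d - 1) × Fin m) (Fin r) ℂ) (V₂ : Matrix (Fin (d - 1) × Fin n) (Fin r) ℂ) :
    polynomialLinearization P d U₂ V₂ = Matrix.fromBlocks
      ((X : ℂ[X]) • constMatrix (U₂ᴴ * hankelS P d * V₂) - constMatrix (U₂ᴴ * hankelT P d * V₂))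
      ((X : ℂ[X]) • constMatrix (U₂ᴴ * coeffColumn P d))
      ((X : ℂ[X]) • constMatrix (coeffRow P d * V₂))
      ((lancasterPencil P d).toBlocks₂₂) := by
  have h := lancasterPencil_eq P d
  generalize (lancasterPencil P d).toBlocks₂₂ = D at h ⊢
  rw [polynomialLinearization, h, Matrix.fromBlocks_multiply, Matrix.fromBlocks_multiply]
  simp only [Matrix.zero_mul, Matrix.mul_zero, add_zero, zero_add, Matrix.one_mul, Matrix.mul_one,
    Matrix.mul_sub, Matrix.sub_mul, Matrix.mul_smul, Matrix.smul_mul, constMatrix_mul, smul_zero,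
    sub_zero]

lemma CompressesLowerRight.mul_right (h : CompressesLowerRight (hankelT P d) U₁ U₂ V₁ V₂) :
    hankelT P d * (V₂ * V₂ᴴ) = hankelT P d := by
  have hV := (fromCols_gram h.unitary_right).2
  calc hankelT P d * (V₂ * V₂ᴴ)
      = U₂ * (U₂ᴴ * hankelT P d * V₂) * V₂ᴴ * (V₂ * V₂ᴴ) := by rw [← h.eq_mul]
    _ = U₂ * (U₂ᴴ * hankelT P d * V₂) * (V₂ᴴ * V₂) * V₂ᴴ := by simp only [Matrix.mul_assoc]
    _ = _ := by rw [hV, Matrix.mul_one, ← h.eq_mul]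

lemma CompressesLowerRight.mul_left (h : CompressesLowerRight (hankelT P d) U₁ U₂ V₁ V₂) :
    U₂ * U₂ᴴ * hankelT P d = hankelT P d := by
  have hU := (fromCols_gram h.unitary_left).2
  calc U₂ * U₂ᴴ * hankelT P d
      = U₂ * U₂ᴴ * (U₂ * (U₂ᴴ * hankelT P d * V₂) * V₂ᴴ) := by rw [← h.eq_mul]
    _ = U₂ * (U₂ᴴ * U₂) * (U₂ᴴ * hankelT P d * V₂) * V₂ᴴ := by simp only [Matrix.mul_assoc]
    _ = _ := by rw [hU, Matrix.mul_one, ← h.eq_mul]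

/-- The leading block of the compressed pencil has no finite eigenvalues. -/
theorem isUnit_evalMatrix_blockA_polynomialLinearization (hP : ∀ i j, (P i j).natDegree ≤ d)
    (h : CompressesLowerRight (hankelT P d) U₁ U₂ V₁ V₂) (z : ℂ) :
    IsUnit (evalMatrix z (blockA (polynomialLinearization P d U₂ V₂))) := by
  rw [polynomialLinearization_eq]
  apply isUnit_of_vecMul_eq_zero
  intro x hx
  change x ᵥ* evalMatrix z (_ - _) = 0 at hx
  simp only [evalMatrix_sub, evalMatrix_X_smul, evalMatrix_constMatrix] at hx
  have hSV := mul_eq_self_of_ker (fun _ => hankelS_mulVec_eq_zero hP) h.mul_right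
  -- Since `S` and `T` absorb `V₂V₂ᴴ`, a left kernel vector of the compressed pencil lifts to one of
  -- the full pencil.
  have hy : (x ᵥ* U₂ᴴ) ᵥ* (z • hankelS P d - hankelT P d) = 0 := by
    calc (x ᵥ* U₂ᴴ) ᵥ* (z • hankelS P d - hankelT P d)
        = (x ᵥ* U₂ᴴ) ᵥ* (z • (hankelS P d * (V₂ * V₂ᴴ)) - hankelT P d * (V₂ * V₂ᴴ)) := by
          rw [hSV, h.mul_right]
      _ = (x ᵥ* (z • (U₂ᴴ * hankelS P d * V₂) - U₂ᴴ * hankelT P d * V₂)) ᵥ* V₂ᴴ := by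
          simp only [Matrix.vecMul_vecMul, Matrix.mul_sub, Matrix.sub_mul, Matrix.mul_smul,
            Matrix.smul_mul, Matrix.mul_assoc]
      _ = 0 := by rw [hx, Matrix.zero_vecMul]
  have hT := vecMul_hankelT_eq_zero_of_pencil hP z hy
  apply eq_zero_of_vecMul_eq_zero h.invertible
  rw [← Matrix.vecMul_vecMul, ← Matrix.vecMul_vecMul, hT, Matrix.zero_vecMul]

theorem isStronglyMinimalLinearization_polynomialLinearization
    (hP : ∀ i j, (P i j).natDegree ≤ d)
    (h : CompressesLowerRight (hankelT P d) U₁ U₂ V₁ V₂) :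
    IsStronglyMinimalLinearization (polynomialLinearization P d U₂ V₂) (toRat P) := by
  have hunit := isUnit_evalMatrix_blockA_polynomialLinearization hP h
  have hSV := mul_eq_self_of_ker (fun _ => hankelS_mulVec_eq_zero hP) h.mul_right
  have hCV := mul_eq_self_of_ker (fun _ => coeffRow_mulVec_eq_zero) h.mul_right
  have hUS := mul_eq_self_of_coker (fun _ => vecMul_hankelS_eq_zero hP) h.mul_left
  have hdet : (blockA (polynomialLinearization P d U₂ V₂)).det ≠ 0 := by
    intro h0
    have h1 := (Matrix.isUnit_iff_isUnit_det _).1 (hunit 0)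
    rw [evalMatrix_det, h0] at h1
    simp at h1
  set L := polynomialLinearization P d U₂ V₂ with hL
  rw [polynomialLinearization_eq] at hL
  have eA : blockA L = (X : ℂ[X]) • constMatrix (U₂ᴴ * hankelS P d * V₂) -
    constMatrix (U₂ᴴ * hankelT P d * V₂) := by rw [hL]; rfl
  have eB : -blockB L = (X : ℂ[X]) • constMatrix (U₂ᴴ * coeffColumn P d) := by
    rw [hL]; exact neg_neg _
  have eC : blockC L = (X : ℂ[X]) • constMatrix (coeffRow P d * V₂) := by rw [hL]; rfl
  have eD : blockD L = (lancasterPencil P d).toBlocks₂₂ := by rw [hL]; rfl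
  refine ⟨⟨?_, hdet, ?_⟩, (isStronglyMinimal_iff _).2 ⟨?_, ?_, ?_, ?_⟩⟩
  · rw [hL]
    rintro (i | i) (j | j)
    · simp only [Matrix.fromBlocks_apply₁₁, Matrix.sub_apply, Matrix.smul_apply, constMatrix,
        Matrix.map_apply, smul_eq_mul]
      compute_degree
    · simp only [Matrix.fromBlocks_apply₁₂, Matrix.smul_apply, constMatrix,
        Matrix.map_apply, smul_eq_mul]
      compute_degree
    · simp only [Matrix.fromBlocks_apply₂₁, Matrix.smul_apply, constMatrix,
        Matrix.map_apply, smul_eq_mul]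
      compute_degree
    · change (X * C _ + C _ : ℂ[X]).natDegree ≤ 1
      compute_degree
  · have hAW : blockA L * (constMatrix V₂ᴴ * powerColumn n d) = blockB L := by
      rw [← neg_inj, eB, eA]
      have e : ((X : ℂ[X]) • constMatrix (U₂ᴴ * hankelS P d * V₂) -
          constMatrix (U₂ᴴ * hankelT P d * V₂)) * (constMatrix V₂ᴴ * powerColumn n d) =
          constMatrix U₂ᴴ * (((X : ℂ[X]) • constMatrix (hankelS P d * (V₂ * V₂ᴴ)) -
          constMatrix (hankelT P d * (V₂ * V₂ᴴ))) * powerColumn n d) := by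
        simp only [constMatrix_mul, Matrix.mul_sub, Matrix.sub_mul, Matrix.mul_smul,
          Matrix.smul_mul, Matrix.mul_assoc]
      rw [e, hSV, h.mul_right, leading_mul_powerColumn hP, Matrix.mul_neg, neg_neg,
        Matrix.mul_smul, ← constMatrix_mul]
    have hCW : blockC L * (constMatrix V₂ᴴ * powerColumn n d) =
        ((X : ℂ[X]) • constMatrix (coeffRow P d)) * powerColumn n d := by
      rw [eC, ← Matrix.mul_assoc, Matrix.smul_mul, ← constMatrix_mul, Matrix.mul_assoc, hCV]
    rw [← hAW, toRat_mul, Matrix.mul_assoc, Matrix.nonsing_inv_mul_cancel_left _ _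
      (isUnit_det_toRat hdet), ← toRat_mul, hCW, ← toRat_add, add_comm, eD,
      coeffRow_mul_powerColumn_add hP]
  · intro z x hx _
    exact eq_zero_of_vecMul_eq_zero (hunit z) hx
  · intro z x hx _
    exact eq_zero_of_mulVec_eq_zero (hunit z) hx
  · intro x h1 h2
    simp only [eA, eB, coeffMatrix_sub, coeffMatrix_constMatrix_one,
      coeffMatrix_X_smul_constMatrix_one, sub_zero] at h1 h2
    apply eq_zero_of_vecMul_eq_zero h.invertible
    rw [← Matrix.vecMul_vecMul, ← Matrix.vecMul_vecMul, vecMul_hankelT_eq_zero,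
      Matrix.zero_vecMul]
    · rw [← hSV, Matrix.vecMul_vecMul, ← Matrix.mul_assoc, ← Matrix.mul_assoc,
        ← Matrix.vecMul_vecMul, h1, Matrix.zero_vecMul]
    · rw [Matrix.vecMul_vecMul, h2]
  · intro x h1 h2
    simp only [eA, eC, coeffMatrix_sub, coeffMatrix_constMatrix_one,
      coeffMatrix_X_smul_constMatrix_one, sub_zero] at h1 h2
    apply eq_zero_of_mulVec_eq_zero h.invertible
    rw [Matrix.mul_assoc, ← Matrix.mulVec_mulVec, ← Matrix.mulVec_mulVec, hankelT_mulVec_eq_zero,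
      Matrix.mulVec_zero]
    · rw [← hUS, Matrix.mulVec_mulVec, Matrix.mul_assoc, Matrix.mul_assoc, ← Matrix.mul_assoc U₂ᴴ,
        ← Matrix.mulVec_mulVec, h1, Matrix.mulVec_zero]
    · rw [Matrix.mulVec_mulVec, h2]

end PolynomialPart

/-! ### Smith form of a polynomial matrix -/

section Smith

/-- Equivalence of polynomial matrices under unimodular transformations. -/
def UnimodularEquiv {p q : Type*} [Fintype p] [DecidableEq p] [Fintype q] [DecidableEq q]
    (A B : Matrix p q ℂ[X]) : Prop :=
  ∃ (U : Matrix p p ℂ[X]) (V : Matrix q q ℂ[X]), IsUnit U.det ∧ IsUnit V.det ∧ U * A * V = B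

namespace UnimodularEquiv

variable {p q : Type*} [Fintype p] [DecidableEq p] [Fintype q] [DecidableEq q]
  {A B D : Matrix p q ℂ[X]}

lemma refl (A : Matrix p q ℂ[X]) : UnimodularEquiv A A := ⟨1, 1, by simp, by simp, by simp⟩

lemma trans (h : UnimodularEquiv A B) (h' : UnimodularEquiv B D) : UnimodularEquiv A D := by
  obtain ⟨U, V, hU, hV, rfl⟩ := h
  obtain ⟨U', V', hU', hV', rfl⟩ := h'
  exact ⟨U' * U, V * V', by rw [Matrix.det_mul]; exact hU'.mul hU,
    by rw [Matrix.det_mul]; exact hV.mul hV', by simp only [Matrix.mul_assoc]⟩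

lemma submatrix (A : Matrix p q ℂ[X]) (e : Equiv.Perm p) (f : Equiv.Perm q) :
    UnimodularEquiv A (A.submatrix e f) := by
  refine ⟨(1 : Matrix p p ℂ[X]).submatrix e id, ((1 : Matrix q q ℂ[X]).submatrix f.symm id), ?_,
    ?_, ?_⟩
  · rw [Matrix.det_permute]; simpa using (Equiv.Perm.sign e).isUnit.map (Int.castRingHom ℂ[X])
  · rw [Matrix.det_permute]; simpa using (Equiv.Perm.sign f).isUnit.map (Int.castRingHom ℂ[X])
  · ext1 i j
    simp [Matrix.mul_apply, Matrix.one_apply, Equiv.symm_apply_eq]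

lemma transvection_mul (A : Matrix p q ℂ[X]) {i j : p} (hij : i ≠ j) (c : ℂ[X]) :
    UnimodularEquiv A (Matrix.transvection i j c * A) :=
  ⟨Matrix.transvection i j c, 1, by rw [Matrix.det_transvection_of_ne _ _ hij]; exact isUnit_one, by simp, by
    rw [Matrix.mul_one]⟩

lemma mul_transvection (A : Matrix p q ℂ[X]) {i j : q} (hij : i ≠ j) (c : ℂ[X]) :
    UnimodularEquiv A (A * Matrix.transvection i j c) :=
  ⟨1, Matrix.transvection i j c, by simp, by rw [Matrix.det_transvection_of_ne _ _ hij]; exact isUnit_one, by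
    rw [Matrix.one_mul]⟩

lemma dvd (h : UnimodularEquiv A B) {c : ℂ[X]} (hc : ∀ i j, c ∣ A i j) (i : p) (j : q) :
    c ∣ B i j := by
  obtain ⟨U, V, -, -, rfl⟩ := h
  rw [Matrix.mul_apply]
  refine Finset.dvd_sum fun l _ => Dvd.dvd.mul_right ?_ _
  rw [Matrix.mul_apply]
  exact Finset.dvd_sum fun l' _ => Dvd.dvd.mul_left (hc _ _) _

end UnimodularEquiv

variable {m n : ℕ}

/-- A matrix bordered by a first row and a first column. -/
def bordered (u : ℂ[X]) (r : Fin n → ℂ[X]) (c : Fin m → ℂ[X]) (M : Matrix (Fin m) (Fin n) ℂ[X]) :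
    Matrix (Fin (m + 1)) (Fin (n + 1)) ℂ[X] :=
  Matrix.of (Fin.cons (Fin.cons u r) fun i => Fin.cons (c i) (M i))

@[simp] lemma bordered_zero_zero (u : ℂ[X]) (r : Fin n → ℂ[X]) (c : Fin m → ℂ[X])
    (M : Matrix (Fin m) (Fin n) ℂ[X]) : bordered u r c M 0 0 = u := rfl

@[simp] lemma bordered_zero_succ (u : ℂ[X]) (r : Fin n → ℂ[X]) (c : Fin m → ℂ[X])
    (M : Matrix (Fin m) (Fin n) ℂ[X]) (j : Fin n) : bordered u r c M 0 j.succ = r j := rfl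

@[simp] lemma bordered_succ_zero (u : ℂ[X]) (r : Fin n → ℂ[X]) (c : Fin m → ℂ[X])
    (M : Matrix (Fin m) (Fin n) ℂ[X]) (i : Fin m) : bordered u r c M i.succ 0 = c i := rfl

@[simp] lemma bordered_succ_succ (u : ℂ[X]) (r : Fin n → ℂ[X]) (c : Fin m → ℂ[X])
    (M : Matrix (Fin m) (Fin n) ℂ[X]) (i : Fin m) (j : Fin n) :
    bordered u r c M i.succ j.succ = M i j := rfl

lemma eq_bordered (A : Matrix (Fin (m + 1)) (Fin (n + 1)) ℂ[X]) :
    A = bordered (A 0 0) (fun j => A 0 j.succ) (fun i => A i.succ 0)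
      (A.submatrix Fin.succ Fin.succ) := by
  ext1 i j
  refine Fin.cases ?_ (fun i => ?_) i <;> refine Fin.cases ?_ (fun j => ?_) j <;> rfl

lemma det_bordered_row_zero (u : ℂ[X]) (c : Fin m → ℂ[X]) (M : Matrix (Fin m) (Fin m) ℂ[X]) :
    (bordered u 0 c M).det = u * M.det := by
  rw [Matrix.det_succ_row_zero, Fin.sum_univ_succ]
  have : (bordered u 0 c M).submatrix Fin.succ Fin.succ = M := rfl
  simp [this]

lemma det_bordered_col_zero (u : ℂ[X]) (r : Fin m → ℂ[X]) (M : Matrix (Fin m) (Fin m) ℂ[X]) :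
    (bordered u r 0 M).det = u * M.det := by
  rw [Matrix.det_succ_column_zero, Fin.sum_univ_succ]
  have : (bordered u r 0 M).submatrix Fin.succ Fin.succ = M := rfl
  simp [this]

lemma bordered_diag_mul {l : ℕ} (u u' : ℂ[X]) (M : Matrix (Fin m) (Fin n) ℂ[X])
    (M' : Matrix (Fin n) (Fin l) ℂ[X]) :
    bordered u 0 0 M * bordered u' 0 0 M' = bordered (u * u') 0 0 (M * M') := by
  ext1 i j
  refine Fin.cases ?_ (fun i => ?_) i <;> refine Fin.cases ?_ (fun j => ?_) j <;>
    simp [Matrix.mul_apply, Fin.sum_univ_succ]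

/-- One block elimination clears both borders once the corner divides them. -/
lemma bordered_elim (d : ℂ[X]) (e : Fin n → ℂ[X]) (f : Fin m → ℂ[X])
    (M : Matrix (Fin m) (Fin n) ℂ[X]) :
    bordered 1 0 (-f) (1 : Matrix (Fin m) (Fin m) ℂ[X]) *
      bordered d (fun j => d * e j) (fun i => d * f i) M *
      bordered 1 (-e) 0 (1 : Matrix (Fin n) (Fin n) ℂ[X]) = bordered d 0 0 (M - Matrix.of fun i j => d * f i * e j) := by
  ext1 i j
  refine Fin.cases ?_ (fun i => ?_) i <;> refine Fin.cases ?_ (fun j => ?_) j <;>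
    simp [Matrix.mul_apply, Fin.sum_univ_succ, Matrix.one_apply] <;> ring

/-- The rectangular diagonal matrix with `s` diagonal entries. -/
noncomputable def rectDiagonal (m n s : ℕ) (δ : ℕ → ℂ[X]) : Matrix (Fin m) (Fin n) ℂ[X] :=
  Matrix.of fun i j => if i.val = j.val ∧ i.val < s then δ i.val else 0

lemma bordered_rectDiagonal (s : ℕ) (d : ℂ[X]) (δ : ℕ → ℂ[X]) :
    bordered d 0 0 (rectDiagonal m n s δ) =
      rectDiagonal (m + 1) (n + 1) (s + 1) (fun i => Nat.casesOn i d δ) := by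
  ext1 i j
  refine Fin.cases ?_ (fun i => ?_) i <;> refine Fin.cases ?_ (fun j => ?_) j <;>
    simp [rectDiagonal]

/-- A nonzero matrix is equivalent to one whose corner has minimal degree in the class. -/
lemma exists_minimal_corner {A : Matrix (Fin (m + 1)) (Fin (n + 1)) ℂ[X]} (hA : A ≠ 0) :
    ∃ B, UnimodularEquiv A B ∧ B 0 0 ≠ 0 ∧
      ∀ B', UnimodularEquiv A B' → ∀ i j, B' i j ≠ 0 → (B 0 0).natDegree ≤ (B' i j).natDegree := by
  have hswap (B : Matrix (Fin (m + 1)) (Fin (n + 1)) ℂ[X]) (i j) (hB : UnimodularEquiv A B) :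
      ∃ B', UnimodularEquiv A B' ∧ B' 0 0 = B i j :=
    ⟨B.submatrix (Equiv.swap 0 i) (Equiv.swap 0 j), hB.trans (.submatrix B _ _), by simp⟩
  have hex : ∃ k, ∃ B, UnimodularEquiv A B ∧ B 0 0 ≠ 0 ∧ (B 0 0).natDegree = k := by
    obtain ⟨i, j, hij⟩ : ∃ i j, A i j ≠ 0 := by
      by_contra! h
      exact hA (by ext1 i j; exact h i j)
    obtain ⟨B, hB, e⟩ := hswap A i j (.refl A)
    exact ⟨_, B, hB, by rwa [e], rfl⟩
  classical
  obtain ⟨B, hB, h0, hdeg⟩ := Nat.find_spec hex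
  refine ⟨B, hB, h0, fun B' hB' i j hij => ?_⟩
  obtain ⟨B'', hB'', e⟩ := hswap B' i j hB'
  rw [hdeg, ← e]
  exact Nat.find_min' hex ⟨B'', hB'', by rwa [e], rfl⟩

lemma natDegree_mod_lt_of_ne_zero {f g : ℂ[X]} (hg : g ≠ 0) (h : f % g ≠ 0) :
    (f % g).natDegree < g.natDegree :=
  natDegree_lt_natDegree h (EuclideanDomain.mod_lt f hg)

/-- Reduction of a nonzero matrix to a bordered diagonal one whose corner divides the rest. -/
lemma exists_bordered_of_ne_zero {A : Matrix (Fin (m + 1)) (Fin (n + 1)) ℂ[X]} (hA : A ≠ 0) :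
    ∃ d M, d ≠ 0 ∧ UnimodularEquiv A (bordered d 0 0 M) ∧ ∀ i j, d ∣ M i j := by
  obtain ⟨B, hB, h0, hmin⟩ := exists_minimal_corner hA
  set d := B 0 0 with hd
  -- A nonzero remainder would be an entry of an equivalent matrix of degree below the minimum. The
  -- claim covers every equivalent matrix with corner `d`, since it is used again after the
  -- elimination.
  have hrow (B' : Matrix (Fin (m + 1)) (Fin (n + 1)) ℂ[X]) (hB' : UnimodularEquiv A B')
      (h' : B' 0 0 = d) (j) : d ∣ B' 0 (Fin.succ j) := by
    rw [← EuclideanDomain.mod_eq_zero]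
    by_contra hr
    have h1 := hmin _ (hB'.trans (.mul_transvection B' (Fin.succ_ne_zero j).symm
      (-(B' 0 j.succ / d)))) 0 j.succ
    have e : (B' * Matrix.transvection 0 j.succ (-(B' 0 j.succ / d))) 0 j.succ =
        B' 0 j.succ % d := by
      rw [Matrix.mul_transvection_apply_same, h', EuclideanDomain.mod_eq_sub_mul_div]; ring
    rw [e] at h1
    exact (h1 hr).not_gt (natDegree_mod_lt_of_ne_zero h0 hr)
  have hcol (i) : d ∣ B (Fin.succ i) 0 := by
    rw [← EuclideanDomain.mod_eq_zero]
    by_contra hr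
    have h1 := hmin _ (hB.trans (.transvection_mul B (Fin.succ_ne_zero i)
      (-(B i.succ 0 / d)))) i.succ 0
    have e : (Matrix.transvection i.succ 0 (-(B i.succ 0 / d)) * B) i.succ 0 =
        B i.succ 0 % d := by
      rw [Matrix.transvection_mul_apply_same, ← hd, EuclideanDomain.mod_eq_sub_mul_div]; ring
    rw [e] at h1
    exact (h1 hr).not_gt (natDegree_mod_lt_of_ne_zero h0 hr)
  choose e he using hrow B hB rfl
  choose f hf using hcol
  have hBeq : B = bordered d (fun j => d * e j) (fun i => d * f i)
      (B.submatrix Fin.succ Fin.succ) := by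
    conv_lhs => rw [eq_bordered B]
    simp only [he, hf, ← hd]
  have hBd : UnimodularEquiv A (bordered d 0 0
      (B.submatrix Fin.succ Fin.succ - Matrix.of fun i j => d * f i * e j)) := by
    refine hB.trans ⟨bordered 1 0 (-f) 1, bordered 1 (-e) 0 1, ?_, ?_, ?_⟩
    · rw [det_bordered_row_zero]; simp
    · rw [det_bordered_col_zero]; simp
    · conv_lhs => rw [hBeq]
      exact bordered_elim _ _ _ _
  refine ⟨d, _, h0, hBd, fun i j => ?_⟩
  -- Adding row `i` to the first row keeps the corner, because the first column is already cleared,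
  -- and brings the inner entries into the first row.
  have h1 := hrow _ (hBd.trans (.transvection_mul _ (Fin.succ_ne_zero i).symm 1))
    (by rw [Matrix.transvection_mul_apply_same]; simp) j
  rw [Matrix.transvection_mul_apply_same] at h1
  simpa using h1

/-- Smith normal form of a polynomial matrix. -/
theorem exists_smithForm : ∀ {m n : ℕ} (A : Matrix (Fin m) (Fin n) ℂ[X]),
    ∃ (s : ℕ) (δ : ℕ → ℂ[X]), s ≤ m ∧ s ≤ n ∧ (∀ i < s, (δ i).Monic) ∧
      (∀ i j, i ≤ j → j < s → δ i ∣ δ j) ∧ UnimodularEquiv A (rectDiagonal m n s δ) := by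
  intro m
  induction m with
  | zero =>
    intro n A
    refine ⟨0, 0, le_rfl, Nat.zero_le _, by simp, by simp, ?_⟩
    rw [Subsingleton.elim (rectDiagonal 0 n 0 0) A]
    exact .refl A
  | succ m ih =>
    intro n A
    by_cases hA : A = 0
    · refine ⟨0, 0, Nat.zero_le _, Nat.zero_le _, by simp, by simp, ?_⟩
      have : rectDiagonal (m + 1) n 0 0 = A := by rw [hA]; ext1 i j; simp [rectDiagonal]
      rw [this]
      exact .refl A
    cases n with
    | zero => exact absurd (Subsingleton.elim A 0) hA
    | succ n =>
      obtain ⟨d, M, hd, hAM, hdvd⟩ := exists_bordered_of_ne_zero hA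
      obtain ⟨s, δ, hm, hn, hmon, hδ, hM⟩ := ih M
      have hdδ (i : ℕ) (hi : i < s) : d ∣ δ i := by
        have := hM.dvd hdvd ⟨i, by omega⟩ ⟨i, by omega⟩
        simpa [rectDiagonal, hi] using this
      obtain ⟨U, V, hU, hV, hUV⟩ := hM
      have hc : C d.leadingCoeff⁻¹ ≠ 0 := C_ne_zero.2 (inv_ne_zero (leadingCoeff_ne_zero.2 hd))
      have hcu : IsUnit (C d.leadingCoeff⁻¹) :=
        isUnit_C.2 (inv_ne_zero (leadingCoeff_ne_zero.2 hd)).isUnit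
      -- The left factor scales the corner by the constant that makes it monic.
      refine ⟨s + 1, fun i => Nat.casesOn i (C d.leadingCoeff⁻¹ * d) δ, by omega, by omega, ?_, ?_,
        hAM.trans ⟨bordered (C d.leadingCoeff⁻¹) 0 0 U, bordered 1 0 0 V, ?_, ?_, ?_⟩⟩
      · rintro (_ | i) hi
        · simp only [mul_comm]
          exact monic_mul_leadingCoeff_inv hd
        · exact hmon i (by omega)
      · rintro (_ | i) (_ | j) hij hj
        · exact dvd_rfl
        · exact (hcu.mul_left_dvd).2 (hdδ j (by omega))
        · omega
        · exact hδ i j (by omega) (by omega)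
      · rw [det_bordered_row_zero]; exact hcu.mul hU
      · rw [det_bordered_row_zero, one_mul]; exact hV
      · rw [bordered_diag_mul, bordered_diag_mul, hUV, mul_one, bordered_rectDiagonal]

/-- Every rational matrix has a Smith–McMillan form. -/
theorem exists_smithMcMillanForm (R : Matrix (Fin m) (Fin n) (RatFunc ℂ)) :
    ∃ (s : ℕ) (ε ψ : Fin s → ℂ[X]), IsSmithMcMillanForm R s ε ψ := by
  -- A common denominator, normalized to the monic `q`, reduces the claim to the Smith form of `q
  -- R`; the reduced fractions `δᵢ / q` then give numerators and denominators.
  obtain ⟨b, hb⟩ := IsLocalization.exist_integer_multiples_of_finite (nonZeroDivisors ℂ[X])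
    (fun x : Fin m × Fin n => R x.1 x.2)
  choose A hA using hb
  have hb0 : (b : ℂ[X]) ≠ 0 := nonZeroDivisors.ne_zero b.2
  set lc := (b : ℂ[X]).leadingCoeff with hlc
  have hlc0 : lc ≠ 0 := leadingCoeff_ne_zero.2 hb0
  set q := (b : ℂ[X]) * C lc⁻¹ with hq
  have hqm : q.Monic := monic_mul_leadingCoeff_inv hb0
  have hq0 : algebraMap ℂ[X] (RatFunc ℂ) q ≠ 0 := RatFunc.algebraMap_ne_zero hqm.ne_zero
  set A' : Matrix (Fin m) (Fin n) ℂ[X] := Matrix.of fun i j => C lc⁻¹ * A (i, j) with hA'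
  have hR : toRat A' = (algebraMap ℂ[X] (RatFunc ℂ) q) • R := by
    ext1 i j
    have := hA (i, j)
    rw [Algebra.smul_def] at this
    simp only [toRat, hA', Matrix.map_apply, Matrix.of_apply, Matrix.smul_apply, map_mul, this, hq,
      smul_eq_mul]
    ring
  obtain ⟨s, δ, hm, hn, hmon, hδ, M, N, hM, hN, hMN⟩ := exists_smithForm A'
  let f (i : ℕ) : RatFunc ℂ :=
    algebraMap ℂ[X] (RatFunc ℂ) (δ i) / algebraMap ℂ[X] (RatFunc ℂ) q
  have hf (i : ℕ) : (f i).num * q = δ i * (f i).denom :=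
    (RatFunc.num_mul_eq_mul_denom_iff hqm.ne_zero).2 rfl
  refine ⟨s, fun i => (f i).num, fun i => (f i).denom, hm, hn, fun i => ?_,
    fun i => RatFunc.monic_denom _, fun i => RatFunc.isCoprime_num_denom _, fun i j hij => ?_,
    fun i j hij => ?_, M, N, hM, hN, ?_⟩
  · refine Monic.of_mul_monic_right hqm ?_
    rw [hf]
    exact (hmon i i.2).mul (RatFunc.monic_denom _)
  -- From `δᵢ ∣ δⱼ` one gets `εⱼ ψᵢ = c ψⱼ εᵢ`. Coprimality within the fractions yields both
  -- divisibility chains from this identity.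
  · obtain ⟨c, hc⟩ := hδ i j hij j.2
    have h : (f j).num * (f i).denom = c * (f j).denom * (f i).num := by
      apply mul_right_cancel₀ hqm.ne_zero
      calc (f j).num * (f i).denom * q = (f j).num * q * (f i).denom := by ring
        _ = c * (f j).denom * (δ i * (f i).denom) := by rw [hf, hc]; ring
        _ = _ := by rw [← hf]; ring
    exact (RatFunc.isCoprime_num_denom (f i)).dvd_of_dvd_mul_right ⟨c * (f j).denom, by
      rw [h, mul_comm]⟩
  · obtain ⟨c, hc⟩ := hδ i j hij j.2
    have h : (f j).num * (f i).denom = c * (f j).denom * (f i).num := by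
      apply mul_right_cancel₀ hqm.ne_zero
      calc (f j).num * (f i).denom * q = (f j).num * q * (f i).denom := by ring
        _ = c * (f j).denom * (δ i * (f i).denom) := by rw [hf, hc]; ring
        _ = _ := by rw [← hf]; ring
    exact (RatFunc.isCoprime_num_denom (f j)).symm.dvd_of_dvd_mul_left ⟨c * (f i).num, by
      rw [h]; ring⟩
  · have h : R = (algebraMap ℂ[X] (RatFunc ℂ) q)⁻¹ • toRat A' := by
      rw [hR, smul_smul, inv_mul_cancel₀ hq0, one_smul]
    rw [h, Matrix.mul_smul, Matrix.smul_mul, ← toRat_mul, ← toRat_mul, hMN]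
    ext1 i j
    simp only [Matrix.smul_apply, toRat, Matrix.map_apply, rectDiagonal, Matrix.of_apply,
      smul_eq_mul]
    split_ifs with h1
    · rw [RatFunc.num_div_denom, inv_mul_eq_div]
    · simp

end Smith

/-! ### Realizations of the dimension of the polar degree -/

section PolarRealization

variable {m n ν : ℕ}

/-- The rational vector `R u` for a polynomial vector `u`. -/
noncomputable def ratMulVec (R : Matrix (Fin m) (Fin n) (RatFunc ℂ)) (u : Fin n → ℂ[X]) :
    Fin m → RatFunc ℂ :=
  R *ᵥ (algebraMap ℂ[X] (RatFunc ℂ) ∘ u)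

/-- The `a`-th Laurent coefficient at infinity of the rational vector `R u`. -/
noncomputable def hankelMap (R : Matrix (Fin m) (Fin n) (RatFunc ℂ)) (a : ℕ) :
    (Fin n → ℂ[X]) →ₗ[ℂ] (Fin m → ℂ) where
  toFun u i := laurentCoeffAtInfinity (ratMulVec R u i) ((a : ℤ) + 1)
  map_add' u v := by
    ext i
    have : algebraMap ℂ[X] (RatFunc ℂ) ∘ (u + v) =
        algebraMap ℂ[X] (RatFunc ℂ) ∘ u + algebraMap ℂ[X] (RatFunc ℂ) ∘ v := by
      ext1 j; simp
    rw [ratMulVec, this, Matrix.mulVec_add, Pi.add_apply, laurentCoeffAtInfinity_add]; rfl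
  map_smul' c u := by
    ext i
    have : algebraMap ℂ[X] (RatFunc ℂ) ∘ (c • u) =
        algebraMap ℂ[X] (RatFunc ℂ) (C c) • (algebraMap ℂ[X] (RatFunc ℂ) ∘ u) := by
      ext1 j; simp [smul_eq_C_mul]
    rw [ratMulVec, this, Matrix.mulVec_smul, Pi.smul_apply, smul_eq_mul,
      laurentCoeffAtInfinity_C_mul]; rfl

lemma hankelMap_apply (R : Matrix (Fin m) (Fin n) (RatFunc ℂ)) (a : ℕ) (u : Fin n → ℂ[X])
    (i : Fin m) :
    hankelMap R a u i = laurentCoeffAtInfinity (ratMulVec R u i) ((a : ℤ) + 1) := rfl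

lemma hankelMap_single (R : Matrix (Fin m) (Fin n) (RatFunc ℂ)) (a : ℕ) (i : Fin m) (j : Fin n) :
    hankelMap R a (Pi.single j 1) i = laurentCoeffAtInfinity (R i j) ((a : ℤ) + 1) := by
  have : algebraMap ℂ[X] (RatFunc ℂ) ∘ (Pi.single j 1 : Fin n → ℂ[X]) = Pi.single j 1 := by
    ext1 l
    by_cases h : l = j
    · subst h; simp
    · simp [h]
  rw [hankelMap_apply, ratMulVec, this, Matrix.mulVec_single_one]; rfl

/-- Multiplication by `λ` shifts the expansion at infinity, so reading one coefficient after `a`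
state steps gives the `a`-th Markov parameter. -/
lemma hankelMap_X_pow_smul (R : Matrix (Fin m) (Fin n) (RatFunc ℂ)) (a : ℕ) (u : Fin n → ℂ[X]) :
    hankelMap R 0 ((X : ℂ[X]) ^ a • u) = hankelMap R a u := by
  have hX (v : Fin n → ℂ[X]) (a : ℕ) : hankelMap R a ((X : ℂ[X]) • v) = hankelMap R (a + 1) v := by
    ext i
    have : algebraMap ℂ[X] (RatFunc ℂ) ∘ ((X : ℂ[X]) • v) =
        algebraMap ℂ[X] (RatFunc ℂ) X • (algebraMap ℂ[X] (RatFunc ℂ) ∘ v) := by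
      ext1 j; simp
    rw [hankelMap_apply, ratMulVec, this, Matrix.mulVec_smul, Pi.smul_apply, smul_eq_mul,
      laurentCoeffAtInfinity_X_mul, hankelMap_apply]
    push_cast; rfl
  have hX' (a : ℕ) : ∀ b, hankelMap R b ((X : ℂ[X]) ^ a • u) = hankelMap R (b + a) u := by
    induction a with
    | zero => simp
    | succ a ih =>
      intro b
      rw [pow_succ', mul_smul, hX, ih, add_assoc, add_comm 1]
  simpa using hX' a 0

lemma forall_hankelMap_eq_zero_iff (R : Matrix (Fin m) (Fin n) (RatFunc ℂ)) (u : Fin n → ℂ[X]) :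
    (∀ a, hankelMap R a u = 0) ↔ ∃ w : Fin m → ℂ[X],
      algebraMap ℂ[X] (RatFunc ℂ) ∘ w = ratMulVec R u := by
  have h (i : Fin m) := exists_algebraMap_eq_iff (ratMulVec R u i)
  constructor
  · intro h0
    choose w hw using fun i => (h i).2 fun a => congrFun (h0 a) i
    exact ⟨w, funext hw⟩
  · rintro ⟨w, hw⟩ a
    ext i
    exact (h i).1 ⟨w i, congrFun hw i⟩ a

/-- A finite-dimensional quotient of the polynomial vectors by those that `R` maps to polynomial
vectors carries an observable and reachable realization of `R`. -/
theorem exists_isRealization_of_ker {V : Type*} [AddCommGroup V] [Module ℂ V]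
    [FiniteDimensional ℂ V] (hν : Module.finrank ℂ V = ν)
    {R : Matrix (Fin m) (Fin n) (RatFunc ℂ)} (π : (Fin n → ℂ[X]) →ₗ[ℂ] V)
    (hπ : Function.Surjective π) (Φ : V →ₗ[ℂ] V) (hΦ : ∀ u, π ((X : ℂ[X]) • u) = Φ (π u))
    (hker : ∀ u, π u = 0 ↔ ∃ w : Fin m → ℂ[X],
      algebraMap ℂ[X] (RatFunc ℂ) ∘ w = ratMulVec R u) :
    ∃ (F : Matrix (Fin ν) (Fin ν) ℂ) (B : Matrix (Fin ν) (Fin n) ℂ)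
      (C : Matrix (Fin m) (Fin ν) ℂ), IsRealization R F B C ∧
      (∀ x, (∀ a : ℕ, (C * F ^ a) *ᵥ x = 0) → x = 0) ∧
      (∀ x, (∀ a : ℕ, x ᵥ* (F ^ a * B) = 0) → x = 0) := by
  let e : V ≃ₗ[ℂ] (Fin ν → ℂ) := (Module.finBasisOfFinrankEq ℂ V hν).equivFun
  obtain ⟨σ, hσ⟩ := LinearMap.exists_rightInverse_of_surjective π (LinearMap.range_eq_top.2 hπ)
  have hσ' (v : V) : π (σ v) = v := LinearMap.congr_fun hσ v
  let F : Matrix (Fin ν) (Fin ν) ℂ := LinearMap.toMatrix' (e.toLinearMap ∘ₗ Φ ∘ₗ e.symm.toLinearMap)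
  let Cm : Matrix (Fin m) (Fin ν) ℂ :=
    LinearMap.toMatrix' (hankelMap R 0 ∘ₗ σ ∘ₗ e.symm.toLinearMap)
  let B : Matrix (Fin ν) (Fin n) ℂ := Matrix.of fun l j => e (π (Pi.single j 1)) l
  have hF (u) : F *ᵥ e (π u) = e (π ((X : ℂ[X]) • u)) := by
    rw [← Matrix.toLin'_apply, Matrix.toLin'_toMatrix']
    simp [hΦ]
  have hFa (a : ℕ) (u) : F ^ a *ᵥ e (π u) = e (π ((X : ℂ[X]) ^ a • u)) := by
    induction a with
    | zero => simp
    | succ a ih => rw [pow_succ', ← Matrix.mulVec_mulVec, ih, hF, smul_smul, ← pow_succ']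
  have hC (u) : Cm *ᵥ e (π u) = hankelMap R 0 u := by
    rw [← Matrix.toLin'_apply, Matrix.toLin'_toMatrix']
    simp only [LinearMap.comp_apply, LinearEquiv.coe_coe, LinearEquiv.symm_apply_apply]
    rw [← sub_eq_zero, ← map_sub]
    -- The output map is independent of the chosen section `σ`: two lifts differ by a vector that
    -- `R` maps to a polynomial one.
    refine (forall_hankelMap_eq_zero_iff R _).2 ((hker _).1 ?_) 0
    rw [map_sub, hσ', sub_self]
  have hCF (a : ℕ) (u) : (Cm * F ^ a) *ᵥ e (π u) = hankelMap R a u := by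
    rw [← Matrix.mulVec_mulVec, hFa, hC, hankelMap_X_pow_smul]
  have hB (M : Matrix (Fin ν) (Fin ν) ℂ) (l j) :
      (M * B) l j = (M *ᵥ e (π (Pi.single j 1))) l := rfl
  refine ⟨F, B, Cm, fun a i j => ?_, fun x hx => ?_, fun x hx => ?_⟩
  · rw [← hankelMap_single, ← hCF]; rfl
  · obtain ⟨u, hu⟩ := hπ (e.symm x)
    have hxu : x = e (π u) := by rw [hu, LinearEquiv.apply_symm_apply]
    have : π u = 0 := (hker u).2 ((forall_hankelMap_eq_zero_iff R u).1 fun a => by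
      rw [← hCF, ← hxu, hx])
    rw [hxu, this, map_zero]
  · let ℓ : (Fin n → ℂ[X]) →ₗ[ℂ] ℂ := (dotProductBilin ℂ ℂ x) ∘ₗ e.toLinearMap ∘ₗ π
    have hℓ (u) : ℓ u = x ⬝ᵥ e (π u) := rfl
    -- The vectors `λ ^ a eⱼ` span `ℂ[λ]ⁿ`, and `ℓ` vanishes on each of them by assumption.
    have hℓ0 : ℓ = 0 := by
      apply LinearMap.pi_ext'
      intro j
      apply Polynomial.lhom_ext'
      intro a
      apply LinearMap.ext_ring
      have h1 : (LinearMap.single ℂ (fun _ : Fin n => ℂ[X]) j) (monomial a (1 : ℂ)) =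
          (X : ℂ[X]) ^ a • (Pi.single j 1 : Fin n → ℂ[X]) := by
        rw [LinearMap.single_apply, ← Pi.single_smul, smul_eq_mul, mul_one,
          monomial_one_right_eq_X_pow]
      simp only [LinearMap.comp_apply, LinearMap.zero_apply]
      rw [h1, hℓ, ← hFa]
      exact congrFun (hx a) j
    apply dotProduct_eq_zero
    intro w
    obtain ⟨u, hu⟩ := hπ (e.symm w)
    rw [← LinearEquiv.apply_symm_apply e w, ← hu, ← hℓ, hℓ0, LinearMap.zero_apply]

lemma comp_algebraMap_mulVec {p q : Type*} [Fintype q] (M : Matrix p q ℂ[X]) (w : q → ℂ[X]) :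
    algebraMap ℂ[X] (RatFunc ℂ) ∘ (M *ᵥ w) = toRat M *ᵥ (algebraMap ℂ[X] (RatFunc ℂ) ∘ w) :=
  funext fun i => RingHom.map_mulVec _ M w i

lemma exists_polynomial_mulVec_iff {R : Matrix (Fin m) (Fin n) (RatFunc ℂ)}
    {M : Matrix (Fin m) (Fin m) ℂ[X]} (hM : IsUnit M.det) (u : Fin n → ℂ[X]) :
    (∃ w : Fin m → ℂ[X], algebraMap ℂ[X] (RatFunc ℂ) ∘ w = ratMulVec R u) ↔
      ∃ w : Fin m → ℂ[X], algebraMap ℂ[X] (RatFunc ℂ) ∘ w = ratMulVec (toRat M * R) u := by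
  constructor
  · rintro ⟨w, hw⟩
    exact ⟨M *ᵥ w, by rw [comp_algebraMap_mulVec, hw, ratMulVec, ratMulVec, Matrix.mulVec_mulVec]⟩
  · rintro ⟨w, hw⟩
    refine ⟨M⁻¹ *ᵥ w, ?_⟩
    rw [comp_algebraMap_mulVec, hw, ratMulVec, ratMulVec, Matrix.mulVec_mulVec, ← Matrix.mul_assoc,
      ← toRat_mul, Matrix.nonsing_inv_mul _ hM, toRat_one, Matrix.one_mul]

/-- Reduction of the coordinates of `N⁻¹ u` modulo the denominators `ψ i`. -/
noncomputable def polarProjection {s : ℕ} (hs : s ≤ n) (N : Matrix (Fin n) (Fin n) ℂ[X])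
    (ψ : Fin s → ℂ[X]) :
    (Fin n → ℂ[X]) →ₗ[ℂ[X]] (∀ i : Fin s, ℂ[X] ⧸ Ideal.span {ψ i}) :=
  LinearMap.pi fun i =>
    (Ideal.span {ψ i}).mkQ ∘ₗ LinearMap.proj (Fin.castLE hs i) ∘ₗ (N⁻¹).mulVecLin

lemma polarProjection_eq_zero_iff {s : ℕ} (hs : s ≤ n) (N : Matrix (Fin n) (Fin n) ℂ[X])
    (ψ : Fin s → ℂ[X]) (u : Fin n → ℂ[X]) :
    polarProjection hs N ψ u = 0 ↔ ∀ i, ψ i ∣ (N⁻¹ *ᵥ u) (Fin.castLE hs i) := by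
  rw [funext_iff]
  refine forall_congr' fun i => ?_
  rw [← Ideal.mem_span_singleton]
  exact Submodule.Quotient.mk_eq_zero _

lemma polarProjection_surjective {s : ℕ} (hs : s ≤ n) {N : Matrix (Fin n) (Fin n) ℂ[X]}
    (hN : IsUnit N.det) (ψ : Fin s → ℂ[X]) : Function.Surjective (polarProjection hs N ψ) := by
  intro y
  choose v hv using fun i => Submodule.mkQ_surjective _ (y i)
  refine ⟨N *ᵥ fun j => if h : j.val < s then v ⟨j.val, h⟩ else 0, ?_⟩
  ext1 i
  have : N⁻¹ *ᵥ (N *ᵥ fun j : Fin n => if h : j.val < s then v ⟨j.val, h⟩ else 0) =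
      fun j : Fin n => if h : j.val < s then v ⟨j.val, h⟩ else 0 := by
    rw [Matrix.mulVec_mulVec, Matrix.nonsing_inv_mul _ hN, Matrix.one_mulVec]
  rw [← hv i]
  change (Ideal.span {ψ i}).mkQ ((N⁻¹ *ᵥ _) (Fin.castLE hs i)) = _
  rw [this]
  simp

/-- Put `v = N⁻¹ u`. As `M` is unimodular, `R u` is polynomial exactly when all `εᵢ vᵢ / ψᵢ` are,
and by coprimality this means `ψᵢ ∣ vᵢ`. -/
lemma IsSmithMcMillanForm.polarProjection_eq_zero_iff {R : Matrix (Fin m) (Fin n) (RatFunc ℂ)}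
    {s : ℕ} {ε ψ : Fin s → ℂ[X]} (h : IsSmithMcMillanForm R s ε ψ)
    {M : Matrix (Fin m) (Fin m) ℂ[X]} {N : Matrix (Fin n) (Fin n) ℂ[X]}
    (hM : IsUnit M.det) (hN : IsUnit N.det)
    (hMN : toRat M * R * toRat N = Matrix.of fun i j =>
      if h : i.val = j.val ∧ i.val < s then
        algebraMap ℂ[X] (RatFunc ℂ) (ε ⟨i.val, h.2⟩) / algebraMap ℂ[X] (RatFunc ℂ) (ψ ⟨i.val, h.2⟩)
      else 0) (u : Fin n → ℂ[X]) :
    polarProjection h.le_cols N ψ u = 0 ↔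
      ∃ w : Fin m → ℂ[X], algebraMap ℂ[X] (RatFunc ℂ) ∘ w = ratMulVec R u := by
  rw [RationalLinearization.polarProjection_eq_zero_iff, exists_polynomial_mulVec_iff hM]
  set v := N⁻¹ *ᵥ u with hv
  have hu : N *ᵥ v = u := by
    rw [hv, Matrix.mulVec_mulVec, Matrix.mul_nonsing_inv _ hN, Matrix.one_mulVec]
  have hψ (i) : algebraMap ℂ[X] (RatFunc ℂ) (ψ i) ≠ 0 :=
    RatFunc.algebraMap_ne_zero (h.monic_den i).ne_zero
  have hR : ratMulVec (toRat M * R) u =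
      (toRat M * R * toRat N) *ᵥ (algebraMap ℂ[X] (RatFunc ℂ) ∘ v) := by
    rw [ratMulVec, ← hu, comp_algebraMap_mulVec, Matrix.mulVec_mulVec]
  have hlt (i : Fin m) (hi : i.val < s) : ratMulVec (toRat M * R) u i =
      algebraMap ℂ[X] (RatFunc ℂ) (ε ⟨i, hi⟩) / algebraMap ℂ[X] (RatFunc ℂ) (ψ ⟨i, hi⟩) *
        algebraMap ℂ[X] (RatFunc ℂ) (v (Fin.castLE h.le_cols ⟨i, hi⟩)) := by
    rw [hR, hMN, Matrix.mulVec, dotProduct,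
      Finset.sum_eq_single (Fin.castLE h.le_cols ⟨i, hi⟩)]
    · simp [hi]
    · intro j _ hj
      rw [Matrix.of_apply, dif_neg, zero_mul]
      rintro ⟨h1, -⟩
      exact hj (Fin.ext h1.symm)
    · simp
  have hge (i : Fin m) (hi : ¬ i.val < s) : ratMulVec (toRat M * R) u i = 0 := by
    rw [hR, hMN, Matrix.mulVec, dotProduct]
    exact Finset.sum_eq_zero fun j _ => by
      rw [Matrix.of_apply, dif_neg (fun h => hi h.2), zero_mul]
  constructor
  · intro hdvd
    choose c hc using hdvd
    refine ⟨fun i => if hi : i.val < s then ε ⟨i, hi⟩ * c ⟨i, hi⟩ else 0, ?_⟩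
    ext1 i
    rw [Function.comp_apply]
    split_ifs with hi
    · rw [hlt i hi, hc, map_mul, map_mul, ← mul_assoc, div_mul_cancel₀ _ (hψ _)]
    · rw [hge i hi, map_zero]
  · rintro ⟨w, hw⟩ i
    have h1 := congrFun hw (Fin.castLE h.le_rows i)
    rw [hlt _ i.2, Function.comp_apply, div_mul_eq_mul_div, eq_div_iff (hψ _), ← map_mul,
      ← map_mul] at h1
    have h2 := RatFunc.algebraMap_injective ℂ h1
    exact (h.coprime i).symm.dvd_of_dvd_mul_left ⟨_, h2.symm.trans (mul_comm _ _)⟩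

/-- A rational matrix of finite polar degree `ν` has an observable and reachable realization of
dimension `ν`. -/
theorem HasFinitePolarDegree.exists_isRealization {R : Matrix (Fin m) (Fin n) (RatFunc ℂ)}
    (h : HasFinitePolarDegree R ν) :
    ∃ (F : Matrix (Fin ν) (Fin ν) ℂ) (B : Matrix (Fin ν) (Fin n) ℂ)
      (C : Matrix (Fin m) (Fin ν) ℂ), IsRealization R F B C ∧
      (∀ x, (∀ a : ℕ, (C * F ^ a) *ᵥ x = 0) → x = 0) ∧
      (∀ x, (∀ a : ℕ, x ᵥ* (F ^ a * B) = 0) → x = 0) := by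
  obtain ⟨s, ε, ψ, hs, hν⟩ := h
  obtain ⟨M, N, hM, hN, hMN⟩ := hs.equivalent
  have hfin (i : Fin s) : Module.Finite ℂ (ℂ[X] ⧸ Ideal.span {ψ i}) :=
    (hs.monic_den i).finite_quotient
  have hrank : Module.finrank ℂ (∀ i : Fin s, ℂ[X] ⧸ Ideal.span {ψ i}) = ν := by
    rw [Module.finrank_pi_fintype, hν]
    exact Finset.sum_congr rfl fun i _ => finrank_quotient_span_eq_natDegree
  let π := polarProjection hs.le_cols N ψ
  refine exists_isRealization_of_ker hrank (π.restrictScalars ℂ)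
    (polarProjection_surjective hs.le_cols hN ψ)
    ((LinearMap.lsmul ℂ[X] (∀ i : Fin s, ℂ[X] ⧸ Ideal.span {ψ i}) X).restrictScalars ℂ)
    (fun u => π.map_smul X u) (hs.polarProjection_eq_zero_iff hM hN hMN)

end PolarRealization

/-- The total polar degree is the rank of all large Hankel matrices. -/
theorem exists_hasFinitePolarDegree_rank_hankelH {m n : ℕ}
    (R : Matrix (Fin m) (Fin n) (RatFunc ℂ)) :
    ∃ K : ℕ, ∀ k : ℕ, K ≤ k → HasFinitePolarDegree R (hankelH R k).rank := by
  obtain ⟨s, ε, ψ, hs⟩ := exists_smithMcMillanForm R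
  have hdeg : HasFinitePolarDegree R (∑ i, (ψ i).natDegree) := ⟨s, ε, ψ, hs, rfl⟩
  obtain ⟨F, B, C, h, hobs, hreach⟩ := hdeg.exists_isRealization
  obtain ⟨K, hK⟩ := h.exists_rank_hankelH_eq hobs hreach
  exact ⟨K, fun k hk => by rw [hK k hk]; exact hdeg⟩

end RationalLinearization

/-! ### The main theorem -/

open RationalLinearization
theorem mainTheorem7 {m n : ℕ} (R : Matrix (Fin m) (Fin n) (RatFunc ℂ)) :
    (∃! S : Matrix (Fin m) (Fin n) ℂ[X] × Matrix (Fin m) (Fin n) (RatFunc ℂ),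
      IsAdditiveDecomposition R S.1 S.2) ∧
    ∀ (P : Matrix (Fin m) (Fin n) ℂ[X]) (Rsp : Matrix (Fin m) (Fin n) (RatFunc ℂ)),
      IsAdditiveDecomposition R P Rsp →
      (∃ K : ℕ, ∀ k : ℕ, K ≤ k → HasFinitePolarDegree Rsp (hankelH Rsp k).rank) ∧
      ∀ (d : ℕ), (∀ i j, (P i j).natDegree ≤ d) →
      ∀ (a b r : ℕ)
        (U₁ : Matrix (Fin (d - 1) × Fin m) (Fin a) ℂ) (U₂ : Matrix (Fin (d - 1) × Fin m) (Fin r) ℂ)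
        (V₁ : Matrix (Fin (d - 1) × Fin n) (Fin b) ℂ) (V₂ : Matrix (Fin (d - 1) × Fin n) (Fin r) ℂ),
      CompressesLowerRight (hankelT P d) U₁ U₂ V₁ V₂ →
      ∀ (k : ℕ) (hk : 0 < k), HasFinitePolarDegree Rsp (hankelH Rsp k).rank →
      ∀ (a' b' rf : ℕ)
        (U₁' : Matrix (Fin k × Fin m) (Fin rf) ℂ) (U₂' : Matrix (Fin k × Fin m) (Fin a') ℂ)
        (V₁' : Matrix (Fin k × Fin n) (Fin rf) ℂ) (V₂' : Matrix (Fin k × Fin n) (Fin b') ℂ),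
      CompressesUpperLeft (hankelH Rsp k) U₁' U₂' V₁' V₂' →
      IsStronglyMinimalLinearization (polynomialLinearization P d U₂ V₂) (toRat P) ∧
      IsStronglyMinimalLinearization (strictlyProperLinearization Rsp hk U₁' V₁') Rsp ∧
      IsStronglyMinimalLinearization
        (coupledPencil (polynomialLinearization P d U₂ V₂)
          (strictlyProperLinearization Rsp hk U₁' V₁')) R := by
  refine ⟨existsUnique_additiveDecomposition R, fun P Rsp hdec =>
    ⟨exists_hasFinitePolarDegree_rank_hankelH Rsp, ?_⟩⟩
  intro d hP a b r U₁ U₂ V₁ V₂ hT k hk hdeg a' b' rf U₁' U₂' V₁' V₂' hH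
  have hpoly := isStronglyMinimalLinearization_polynomialLinearization hP hT
  -- Makes the dimension of the realization literally the number `rf` of columns of `U₁'`.
  rw [← hH.rank_eq] at hdeg
  obtain ⟨F, B, Cm, hreal, -, -⟩ := hdeg.exists_isRealization
  have hsp := hreal.strictlyProperLinearization hdec.1 hk hH
  refine ⟨hpoly, hsp, ?_⟩
  rw [hdec.2]
  refine hpoly.coupledPencil hsp rfl
    (isUnit_evalMatrix_blockA_polynomialLinearization hP hT) ?_
  have : coeffMatrix (blockA (strictlyProperLinearization Rsp hk U₁' V₁')) 1 =
      -(U₁'ᴴ * hankelH Rsp k * V₁') := by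
    change coeffMatrix (constMatrix _ - (X : ℂ[X]) • constMatrix _) 1 = _
    rw [coeffMatrix_sub, coeffMatrix_constMatrix_one, coeffMatrix_X_smul_constMatrix_one, zero_sub]
  rw [this]
  exact hH.invertible.neg
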